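/- Let $\sigma\in\{1,-1\}$ and $x\in\mathbb R$, let $r_1,r_2\in H^1(\mathbb R)$ be complex-valued with $|r_1(z)|\le 1$ and $|r_2(z)|\le 1$ for almost every $z\in\mathbb R$, and put $$ S(z)=S(x;z)=\begin{pmatrix}\sigma r_1(z)r_2(z) & \sigma r_2(z)e^{2ixz}\\ r_1(z)e^{-2ixz} & 0\end{pmatrix},\qquad z\in\mathbb R . $$ For $m\ge 0$ let $L^2(\mathbb R)$ denote the space of square integrable functions on $\mathbb R$ with values in the complex $m\times 2$ matrices, with the norm $\|\Psi\|_{L^2}^2=\int_{\mathbb R}\sum_{i,j}|\Psi_{ij}(z)|^2\,dz$ (so $m=1$ gives row vectors and $m=2$ gives $2\times2$ matrices). Let $$ P^-(f)(z)=\lim_{\varepsilon\searrow0}\frac1{2\pi i}\int_{\mathbb R}\frac{f(\zeta)}{\zeta-(z-i\varepsilon)}\,d\zeta ,\qquad z\in\mathbb R, $$ applied entrywise, and $P_S^-\Psi=P^-(\Psi S)$. (1) For every $\Psi\in L^2(\mathbb R)$ the limit defining $P_S^-\Psi(z)$ exists for almost every $z$, and $P_S^-\Psi\in L^2(\mathbb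 R)$. For every $F\in L^2(\mathbb R)$ there is a unique $\Psi\in L^2(\mathbb R)$ such that $(I-P_S^-)\Psi=F$ almost everywhere. (2) The inverse $(I-P_S^-)^{-1}$ is a bounded linear operator on $L^2(\mathbb R)$. (3) The bound depends only on the sup norms of $r_1,r_2$ as long as these are not both equal to $1$: for all real $\rho_1,\rho_2\le 1$ with $\rho_1+\rho_2<2$ there is a constant $c>0$, depending only on $\rho_1$ and $\rho_2$, such that for all $\sigma\in\{1,-1\}$, $x\in\mathbb R$, $m\ge0$ and all $r_1,r_2\in H^1(\mathbb R)$ with $\|r_1\|_{L^\infty}\le\max(\rho_1,0)$ and $\|r_2\|_{L^\infty}\le\max(\rho_2,0)$, $$ \|(I-P_S^-)^{-1}f\|_{L^2}\le c\,\|f\|_{L^2}\qquad\text{for every } f\in L^2(\mathbb R). $$ -/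

import Mathlib

open MeasureTheory Filter Topology Matrix
open scoped SchwartzMap ENNReal

attribute [local instance] Matrix.frobeniusNormedAddCommGroup Matrix.frobeniusNormedSpace

noncomputable section

/-- Membership of a function `r : ℝ → ℂ` in the Sobolev space `H¹(ℝ)`: it is square integrable and
the tempered distribution that it defines has Sobolev regularity `1` in the `L²` scale. -/
def MemH1 (r : ℝ → ℂ) : Prop :=
  ∃ h : MemLp r 2 volume,
    TemperedDistribution.MemSobolev 1 2 (Lp.toTemperedDistribution (h.toLp r))

/-- The Cauchy integral `(2πi)⁻¹ ∫_ℝ f(ζ) / (ζ - w) dζ`, for `w` off the real line. -/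
def cauchyIntegral (f : ℝ → ℂ) (w : ℂ) : ℂ :=
  (2 * Real.pi * Complex.I)⁻¹ * ∫ ζ : ℝ, f ζ / ((ζ : ℂ) - w)

/-- The limit defining `P⁻ f` at `z` is `l`: the Cauchy integral at `z - iε` tends to `l` as
`ε ↘ 0`. -/
def HasPlemeljMinusAt (f : ℝ → ℂ) (z : ℝ) (l : ℂ) : Prop :=
  Tendsto (fun ε : ℝ => cauchyIntegral f ((z : ℂ) - Complex.I * ε)) (𝓝[>] 0) (𝓝 l)

/-- The Plemelj projection `P⁻ f (z) = lim_{ε ↘ 0} (2πi)⁻¹ ∫_ℝ f(ζ) / (ζ - (z - iε)) dζ`. -/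
def plemeljMinus (f : ℝ → ℂ) (z : ℝ) : ℂ :=
  limUnder (𝓝[>] (0 : ℝ)) fun ε : ℝ => cauchyIntegral f ((z : ℂ) - Complex.I * ε)

/-- The matrix `S(x; z)`, that is, the jump matrix minus the identity. -/
def jumpS (σ : ℝ) (r₁ r₂ : ℝ → ℂ) (x z : ℝ) : Matrix (Fin 2) (Fin 2) ℂ :=
  !![σ * r₁ z * r₂ z, σ * r₂ z * Complex.exp (2 * Complex.I * x * z);
    r₁ z * Complex.exp (-2 * Complex.I * x * z), 0]

/-- The space `L²(ℝ)` of functions with values in the `m × 2` complex matrices, normed by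
`‖Ψ‖² = ∫ ∑ i j, |Ψ i j|²` (row vectors for `m = 1`, `2 × 2` matrices for `m = 2`). -/
abbrev L2Mat (m : ℕ) : Type := Lp (Matrix (Fin m) (Fin 2) ℂ) 2 (volume : Measure ℝ)

/-- `P_S⁻ Ψ = P⁻(Ψ S)`, with `P⁻` acting on each entry of the matrix product. -/
def plemeljS {m : ℕ} (S : ℝ → Matrix (Fin 2) (Fin 2) ℂ) (Ψ : ℝ → Matrix (Fin m) (Fin 2) ℂ)
    (z : ℝ) : Matrix (Fin m) (Fin 2) ℂ :=
  Matrix.of fun i j => plemeljMinus (fun ζ => (Ψ ζ * S ζ) i j) z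

/-- `(I - P_S⁻) Ψ = F` in `L²(ℝ)`. -/
def SolvesEq {m : ℕ} (S : ℝ → Matrix (Fin 2) (Fin 2) ℂ) (Ψ F : L2Mat m) : Prop :=
  ∀ᵐ z : ℝ, Ψ z - plemeljS S Ψ z = F z

end

noncomputable section

/-! ### Almost everywhere convergence of Poisson integrals -/

/-! Let `P` and `Q` be the orthogonal projections of `L²` onto the Hardy space of the upper half
plane and onto its complement. By the almost everywhere convergence of Poisson integrals, `P⁻ = -Q`
(`ae_hasPlemeljMinusAt`), so the equation reads `Ψ + Q(ΨS) = F` and decouples into rows.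

Let `A` and `B` be multiplication by `σ r₂ e^{2ixz}` and by `r₁ e^{-2ixz}`. A row `(a, b)` satisfies
`a + QB(Aa + b) = f` and `b + QAa = g`. The new unknown `s = Aa + b` turns this into the single
equation `s + Ks = g + PAf` with `K = PAQB` (`solvesRow_iff`). Since `‖K‖ ≤ ‖A‖ ‖B‖`, a product of
sup norms below 1 gives the explicit bound of `SolvesRow.norm_le`.

If both sup norms may be 1, `K` need not be a strict contraction, and the Fredholm alternative takes
over. Uniqueness: `s = -Ks` puts `s` in the Hardy space and forces `‖s‖ ≤ ‖Bs‖`, so `s` vanishes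
where `|r₁| < 1`. As an `H¹` function, `r₁` is continuous and tends to 0 at infinity, so `s`
vanishes outside a bounded set; analytic continuation of its Cauchy transform around that set gives
`s = 0`. Existence: `KP = PA(QBP)` contains the Hankel operator `QBP`, which is compact because its
symbol is continuous and vanishes at infinity (`isCompactOperator_hankel`). That compactness follows
from Stone–Weierstrass, since Cauchy kernels have commutators with `Q` of finite rank. -/

theorem setLIntegral_Ioc_sqrt_div {ε a c : ℝ} (hε : 0 < ε) (ha : 0 < a) (hc : 0 ≤ c) :
    ∫⁻ t in Set.Ioc 0 a, ENNReal.ofReal (c * √(ε / t)) = ENNReal.ofReal (2 * c * √(ε * a)) := by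
  have hint : IntervalIntegrable (fun t : ℝ => c * √ε * t ^ (-(1 / 2) : ℝ)) volume 0 a :=
    (intervalIntegral.intervalIntegrable_rpow' (by norm_num)).const_mul _
  have hcongr : ∀ t ∈ Set.Ioc 0 a, c * √(ε / t) = c * √ε * t ^ (-(1 / 2) : ℝ) := by
    intro t ht
    rw [Real.sqrt_div hε.le, Real.rpow_neg ht.1.le, ← Real.sqrt_eq_rpow]
    ring
  have hval : ∫ t in (0 : ℝ)..a, c * √ε * t ^ (-(1 / 2) : ℝ) = 2 * c * √(ε * a) := by
    rw [intervalIntegral.integral_const_mul, integral_rpow (Or.inl (by norm_num)),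
      Real.sqrt_mul hε.le, Real.sqrt_eq_rpow a]
    norm_num
    ring
  rw [setLIntegral_congr_fun measurableSet_Ioc
    (fun t ht => congrArg ENNReal.ofReal (hcongr t ht)),
    ← ofReal_integral_eq_lintegral_ofReal, ← intervalIntegral.integral_of_le ha.le, hval]
  · exact (intervalIntegrable_iff_integrableOn_Ioc_of_le ha.le).1 hint
  · refine (ae_restrict_mem measurableSet_Ioc).mono fun t ht => ?_
    have := ht.1
    positivity

/-- Layer cake: the set where the kernel exceeds `t` lies in the ball of radius `√(ε/t)` and is
empty for `t > 1/ε`. Radii below `r₀` contribute at most `2η`; radii at least `r₀` force `t ≤ ε/r₀²`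
and contribute `2Cε/r₀`. -/
theorem lintegral_poisson_le {μ : Measure ℝ} {z ε η C r₀ : ℝ} (hε : 0 < ε) (hη : 0 ≤ η)
    (hC : 0 ≤ C) (hr₀ : 0 < r₀)
    (hsmall : ∀ r, 0 < r → r < r₀ → μ (Metric.ball z r) ≤ ENNReal.ofReal (η * r))
    (hlarge : ∀ r, r₀ ≤ r → μ (Metric.ball z r) ≤ ENNReal.ofReal (C * r)) :
    ∫⁻ t, ENNReal.ofReal (ε / ((t - z) ^ 2 + ε ^ 2)) ∂μ ≤
      ENNReal.ofReal (2 * η + 2 * C * ε / r₀) := by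
  have hpos : ∀ t : ℝ, 0 < (t - z) ^ 2 + ε ^ 2 := fun t => by positivity
  rw [lintegral_eq_lintegral_meas_lt μ (Eventually.of_forall fun t => by
    have := hpos t; simp only [Pi.zero_apply]; positivity) (by fun_prop)]
  have hsub : ∀ t : ℝ, 0 < t →
      {a : ℝ | t < ε / ((a - z) ^ 2 + ε ^ 2)} ⊆ Metric.ball z √(ε / t) := by
    intro t ht a ha
    simp only [Set.mem_ofPred_eq, lt_div_iff₀ (hpos a)] at ha
    rw [Metric.mem_ball, Real.dist_eq]
    apply Real.lt_sqrt_of_sq_lt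
    rw [sq_abs, lt_div_iff₀ ht]
    nlinarith [mul_pos ht (pow_pos hε 2)]
  have hempty : ∀ t : ℝ, ε⁻¹ < t → {a : ℝ | t < ε / ((a - z) ^ 2 + ε ^ 2)} = ∅ := by
    intro t ht
    refine Set.eq_empty_of_forall_notMem fun a ha => ?_
    simp only [Set.mem_ofPred_eq, lt_div_iff₀ (hpos a)] at ha
    have h1 : 1 < t * ε := by
      have := mul_lt_mul_of_pos_right ht hε
      rwa [inv_mul_cancel₀ hε.ne'] at this
    have ht0 : 0 < t := (inv_pos.2 hε).trans ht
    nlinarith [mul_nonneg ht0.le (sq_nonneg (a - z))]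
  have hbound : ∀ t ∈ Set.Ioi (0 : ℝ), μ {a : ℝ | t < ε / ((a - z) ^ 2 + ε ^ 2)} ≤
      (Set.Ioc 0 ε⁻¹).indicator (fun t => ENNReal.ofReal (η * √(ε / t))) t +
      (Set.Ioc 0 (ε / r₀ ^ 2)).indicator (fun t => ENNReal.ofReal (C * √(ε / t))) t := by
    intro t ht
    have ht : 0 < t := ht
    rcases lt_or_ge ε⁻¹ t with h | h
    · rw [hempty t h, measure_empty]; exact zero_le
    rcases lt_or_ge √(ε / t) r₀ with hr | hr
    · refine le_trans ((measure_mono (hsub t ht)).trans (hsmall _ (by positivity) hr)) ?_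
      rw [Set.indicator_of_mem (show t ∈ Set.Ioc 0 ε⁻¹ from ⟨ht, h⟩)]
      exact le_self_add
    · refine le_trans ((measure_mono (hsub t ht)).trans (hlarge _ hr)) ?_
      have : t ≤ ε / r₀ ^ 2 := by
        rw [Real.le_sqrt hr₀.le (by positivity), le_div_iff₀ ht] at hr
        rw [le_div_iff₀ (by positivity)]
        linarith
      rw [Set.indicator_of_mem (show t ∈ Set.Ioc 0 (ε / r₀ ^ 2) from ⟨ht, this⟩)]
      exact le_add_self
  refine (setLIntegral_mono' measurableSet_Ioi hbound).trans ?_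
  refine (setLIntegral_le_lintegral _ _).trans ?_
  rw [lintegral_add_left (Measurable.indicator (by fun_prop) measurableSet_Ioc),
    lintegral_indicator measurableSet_Ioc, lintegral_indicator measurableSet_Ioc,
    setLIntegral_Ioc_sqrt_div hε (by positivity) hη,
    setLIntegral_Ioc_sqrt_div hε (by positivity) hC, ← ENNReal.ofReal_add (by positivity)
      (by positivity)]
  apply ENNReal.ofReal_le_ofReal
  rw [mul_inv_cancel₀ hε.ne', Real.sqrt_one, show ε * (ε / r₀ ^ 2) = (ε / r₀) ^ 2 by ring,
    Real.sqrt_sq (by positivity)]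
  apply le_of_eq
  ring

theorem integral_poisson {ε : ℝ} (hε : 0 < ε) (z : ℝ) :
    ∫ t : ℝ, ε / ((t - z) ^ 2 + ε ^ 2) = Real.pi := by
  rw [integral_sub_right_eq_self (fun t : ℝ => ε / (t ^ 2 + ε ^ 2)) z]
  have h := Measure.integral_comp_div (fun t : ℝ => (1 + t ^ 2)⁻¹) ε
  rw [integral_univ_inv_one_add_sq, abs_of_pos hε, smul_eq_mul] at h
  rw [← mul_left_cancel_iff_of_pos hε, ← h, ← integral_const_mul]
  congr 1 with t
  field_simp
  ring

theorem integrable_poisson {ε : ℝ} (hε : 0 < ε) (z : ℝ) :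
    Integrable fun t : ℝ => ε / ((t - z) ^ 2 + ε ^ 2) :=
  .of_integral_ne_zero (by rw [integral_poisson hε]; positivity)

/-- At almost every point, the Poisson integrals of an `L²` function converge to its value. -/
theorem ae_tendsto_poisson {f : ℝ → ℂ} (hf : MemLp f 2 volume) :
    ∀ᵐ z : ℝ, Tendsto (fun ε : ℝ => ∫ t : ℝ, ((ε / ((t - z) ^ 2 + ε ^ 2) : ℝ) : ℂ) * f t)
      (𝓝[>] 0) (𝓝 (Real.pi * f z)) := by
  have hsq : Integrable (fun t => ‖f t‖ ^ 2) := hf.integrable_norm_pow two_ne_zero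
  have hloc : LocallyIntegrable f volume := hf.locallyIntegrable (by norm_num)
  filter_upwards [IsUnifLocDoublingMeasure.ae_tendsto_average_norm_sub volume hloc 1] with z hz
  have hz' : Tendsto (fun r : ℝ => ⨍ y in Metric.closedBall z r, ‖f y - f z‖) (𝓝[>] 0) (𝓝 0) :=
    hz (fun _ => z) id tendsto_id (by
      filter_upwards [self_mem_nhdsWithin] with r hr
      exact Metric.mem_closedBall_self (by simpa using le_of_lt hr))
  set M : ℝ := ∫ t, ‖f t‖ ^ 2 with hM
  have hM0 : 0 ≤ M := integral_nonneg fun t => by positivity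
  set g : ℝ → ℝ := fun t => ‖f t - f z‖ with hg
  have hgm : AEStronglyMeasurable g volume :=
    (hf.aestronglyMeasurable.sub aestronglyMeasurable_const).norm
  have hgloc : ∀ r, IntegrableOn g (Metric.closedBall z r) := fun r =>
    ((hloc.integrableOn_isCompact (isCompact_closedBall z r)).sub
      (integrableOn_const (measure_closedBall_lt_top.ne))).norm
  -- At a Lebesgue point, `|f - f z| dt` gives a ball of radius `r` mass `o(r)` as `r → 0`; the `L²`
  -- bound makes this mass `O(r)` for large `r`.
  set μ : Measure ℝ := volume.withDensity fun t => ENNReal.ofReal (g t) with hμ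
  have hμball : ∀ r, μ (Metric.ball z r) ≤
      ENNReal.ofReal (∫ t in Metric.closedBall z r, g t) := by
    intro r
    rw [hμ, withDensity_apply _ Metric.isOpen_ball.measurableSet,
      ofReal_integral_eq_lintegral_ofReal (hgloc r)
        (Eventually.of_forall fun t => norm_nonneg _)]
    exact lintegral_mono_set Metric.ball_subset_closedBall
  have hlarge : ∀ r₀ > 0, ∀ r, r₀ ≤ r →
      μ (Metric.ball z r) ≤ ENNReal.ofReal ((2 + 2 * ‖f z‖ + M / r₀) * r) := by
    intro r₀ hr₀ r hr
    refine (hμball r).trans (ENNReal.ofReal_le_ofReal ?_)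
    have hr0 : 0 < r := hr₀.trans_le hr
    have h1 : ∫ t in Metric.closedBall z r, g t ≤
        ∫ t in Metric.closedBall z r, (‖f t‖ ^ 2 + (1 + ‖f z‖)) := by
      refine setIntegral_mono (hgloc r)
        (hsq.integrableOn.add (integrableOn_const measure_closedBall_lt_top.ne)) fun t => ?_
      have := norm_sub_le (f t) (f z)
      simp only [hg]
      nlinarith [sq_nonneg (‖f t‖ - 1), norm_nonneg (f t)]
    rw [integral_add hsq.integrableOn (integrableOn_const measure_closedBall_lt_top.ne),
      setIntegral_const, Real.volume_real_closedBall hr0.le, smul_eq_mul] at h1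
    have h2 : ∫ t in Metric.closedBall z r, ‖f t‖ ^ 2 ≤ M :=
      setIntegral_le_integral hsq (Eventually.of_forall fun t => by positivity)
    have h3 : M ≤ M / r₀ * r := by
      rw [div_mul_eq_mul_div, le_div_iff₀ hr₀]
      exact mul_le_mul_of_nonneg_left hr hM0
    nlinarith
  have hsmall : ∀ η > 0, ∃ r₀ > 0, ∀ r, 0 < r → r < r₀ →
      μ (Metric.ball z r) ≤ ENNReal.ofReal (η * r) := by
    intro η hη
    have := (tendsto_order.1 hz').2 (η / 2) (by positivity)
    obtain ⟨r₀, hr₀, h⟩ := mem_nhdsGT_iff_exists_Ioo_subset.1 this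
    refine ⟨r₀, hr₀, fun r hr hr' => (hμball r).trans (ENNReal.ofReal_le_ofReal ?_)⟩
    have h1 : ⨍ y in Metric.closedBall z r, g y < η / 2 := h ⟨hr, hr'⟩
    rw [setAverage_eq, Real.volume_real_closedBall hr.le, smul_eq_mul,
      inv_mul_lt_iff₀ (by positivity)] at h1
    linarith
  rw [Metric.tendsto_nhds]
  intro δ hδ
  -- With `η = δ/8` and `ε < δr₀/(8C)`, each of the two terms `2η` and `2Cε/r₀` is at most `δ/4`.
  obtain ⟨r₀, hr₀, hr⟩ := hsmall (δ / 8) (by positivity)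
  set C := 2 + 2 * ‖f z‖ + M / r₀ with hC
  have hC0 : 0 < C := by positivity
  have hev : ∀ᶠ ε : ℝ in 𝓝[>] 0, ε < δ * r₀ / (8 * C) :=
    nhdsWithin_le_nhds (Iio_mem_nhds (by positivity))
  filter_upwards [hev, self_mem_nhdsWithin] with ε hε1 hε
  have hε : 0 < ε := hε
  have hp0 : ∀ t : ℝ, 0 ≤ ε / ((t - z) ^ 2 + ε ^ 2) := fun t => by positivity
  have hlin : ∫⁻ t, ENNReal.ofReal (ε / ((t - z) ^ 2 + ε ^ 2) * g t) ≤
      ENNReal.ofReal (2 * (δ / 8) + 2 * C * ε / r₀) := by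
    refine le_trans (le_of_eq ?_)
      (lintegral_poisson_le hε (by positivity) hC0.le hr₀ hr (hlarge r₀ hr₀))
    rw [hμ, lintegral_withDensity_eq_lintegral_mul₀ (by fun_prop) (by fun_prop)]
    refine lintegral_congr fun t => ?_
    rw [ENNReal.ofReal_mul (hp0 t), Pi.mul_apply, mul_comm]
  have hpi := integrable_poisson hε z
  have hdiffmeas : AEStronglyMeasurable
      (fun t : ℝ => ((ε / ((t - z) ^ 2 + ε ^ 2) : ℝ) : ℂ) * (f t - f z)) volume :=
    hpi.ofReal.aestronglyMeasurable.mul (hf.aestronglyMeasurable.sub aestronglyMeasurable_const)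
  have hnorm : ∀ t : ℝ, ‖((ε / ((t - z) ^ 2 + ε ^ 2) : ℝ) : ℂ) * (f t - f z)‖ =
      ε / ((t - z) ^ 2 + ε ^ 2) * g t := fun t => by
    rw [norm_mul, Complex.norm_real, Real.norm_of_nonneg (hp0 t)]
  have hint : Integrable (fun t : ℝ => ((ε / ((t - z) ^ 2 + ε ^ 2) : ℝ) : ℂ) * (f t - f z)) := by
    refine ⟨hdiffmeas, ?_⟩
    rw [hasFiniteIntegral_iff_norm]
    simp only [hnorm]
    exact hlin.trans_lt ENNReal.ofReal_lt_top
  have hconst : Integrable fun t : ℝ => ((ε / ((t - z) ^ 2 + ε ^ 2) : ℝ) : ℂ) * f z :=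
    hpi.ofReal.mul_const _
  have hsplit : ∫ t : ℝ, ((ε / ((t - z) ^ 2 + ε ^ 2) : ℝ) : ℂ) * f t =
      (∫ t : ℝ, ((ε / ((t - z) ^ 2 + ε ^ 2) : ℝ) : ℂ) * (f t - f z)) + Real.pi * f z := by
    rw [← integral_poisson hε z, ← integral_complex_ofReal, ← integral_mul_const,
      ← integral_add hint hconst]
    congr 1 with t
    ring
  rw [hsplit, dist_eq_norm, add_sub_cancel_right]
  calc ‖∫ t : ℝ, ((ε / ((t - z) ^ 2 + ε ^ 2) : ℝ) : ℂ) * (f t - f z)‖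
      ≤ (∫⁻ t, ENNReal.ofReal
          ‖((ε / ((t - z) ^ 2 + ε ^ 2) : ℝ) : ℂ) * (f t - f z)‖).toReal :=
        norm_integral_le_lintegral_norm _
    _ ≤ 2 * (δ / 8) + 2 * C * ε / r₀ := by
        simp only [hnorm]
        exact ENNReal.toReal_le_of_le_ofReal (by positivity) hlin
    _ < δ := by
        rw [lt_div_iff₀ (by positivity)] at hε1
        have : 2 * C * ε / r₀ < δ / 2 := by
          rw [div_lt_iff₀ hr₀]
          linarith [mul_pos hδ hr₀]
        linarith

/-! ### Cauchy kernels, the Hardy space and the Plemelj projection -/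

/-- The Cauchy kernel `ζ ↦ (ζ - w)⁻¹` on the real line. -/
def cauchyKernel (w : ℂ) (ζ : ℝ) : ℂ := ((ζ : ℂ) - w)⁻¹

theorem ofReal_sub_ne_zero {w : ℂ} (hw : w.im ≠ 0) (ζ : ℝ) : (ζ : ℂ) - w ≠ 0 := by
  intro h
  apply hw
  have := congrArg Complex.im h
  simpa using this

theorem continuous_cauchyKernel {w : ℂ} (hw : w.im ≠ 0) : Continuous (cauchyKernel w) :=
  (Complex.continuous_ofReal.sub continuous_const).inv₀ (ofReal_sub_ne_zero hw)

theorem normSq_ofReal_sub (ζ : ℝ) (w : ℂ) :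
    ‖(ζ : ℂ) - w‖ ^ 2 = (ζ - w.re) ^ 2 + w.im ^ 2 := by
  rw [← Complex.normSq_eq_norm_sq, Complex.normSq_apply]
  simp
  ring

theorem memLp_two_cauchyKernel {w : ℂ} (hw : w.im ≠ 0) : MemLp (cauchyKernel w) 2 volume := by
  rw [memLp_two_iff_integrable_sq_norm (continuous_cauchyKernel hw).aestronglyMeasurable]
  refine ((integrable_poisson (abs_pos.2 hw) w.re).const_mul |w.im|⁻¹).congr
    (Eventually.of_forall fun ζ => ?_)
  simp only [cauchyKernel]
  rw [norm_inv, inv_pow, normSq_ofReal_sub, sq_abs]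
  have := abs_pos.2 hw
  field_simp

theorem norm_cauchyKernel_le {w : ℂ} (hw : w.im ≠ 0) (ζ : ℝ) :
    ‖cauchyKernel w ζ‖ ≤ |w.im|⁻¹ := by
  rw [cauchyKernel, norm_inv]
  refine inv_anti₀ (abs_pos.2 hw) ?_
  have := Complex.abs_im_le_norm ((ζ : ℂ) - w)
  simpa using this

theorem conj_cauchyKernel (w : ℂ) (ζ : ℝ) :
    (starRingEnd ℂ) (cauchyKernel w ζ) = cauchyKernel ((starRingEnd ℂ) w) ζ := by
  simp [cauchyKernel]

theorem cauchyKernel_mul {w v : ℂ} (hw : w.im ≠ 0) (hv : v.im ≠ 0) (hwv : w ≠ v) (ζ : ℝ) :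
    cauchyKernel w ζ * cauchyKernel v ζ =
      (w - v)⁻¹ * (cauchyKernel w ζ - cauchyKernel v ζ) := by
  have h1 := ofReal_sub_ne_zero hw ζ
  have h2 := ofReal_sub_ne_zero hv ζ
  have h3 := sub_ne_zero.2 hwv
  simp only [cauchyKernel]
  field_simp
  ring

theorem tendsto_cauchyKernel (w : ℂ) :
    Tendsto (cauchyKernel w) (cocompact ℝ) (𝓝 0) := by
  refine tendsto_inv₀_cobounded.comp ?_
  rw [← tendsto_norm_atTop_iff_cobounded]
  have h : Tendsto (fun ζ : ℝ => ‖ζ‖ - ‖w‖) (cocompact ℝ) atTop :=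
    tendsto_atTop_add_const_right _ _ tendsto_norm_cocompact_atTop
  refine tendsto_atTop_mono (fun ζ => ?_) h
  simpa using norm_sub_norm_le (ζ : ℂ) w

/-- Both poles lie in the upper half plane. In place of residues, explicit antiderivatives vanishing
at both ends are used: `-1/(ζ - w)` for a double pole, otherwise `(w - v)⁻¹ log ((ζ - w)/(ζ - v))`.
-/
theorem integral_cauchyKernel_mul_eq_zero {w v : ℂ} (hw : 0 < w.im) (hv : 0 < v.im) :
    ∫ ζ : ℝ, cauchyKernel w ζ * cauchyKernel v ζ = 0 := by
  have hint : Integrable fun ζ : ℝ => cauchyKernel w ζ * cauchyKernel v ζ :=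
    (memLp_two_cauchyKernel hw.ne').integrable_mul (memLp_two_cauchyKernel hv.ne')
  have hat : atTop ≤ cocompact ℝ := atTop_le_cocompact
  have hab : atBot ≤ cocompact ℝ := atBot_le_cocompact
  have hd : ∀ (u : ℂ) (ζ : ℝ), HasDerivAt (fun ζ : ℝ => (ζ : ℂ) - u) 1 ζ := fun u ζ =>
    (Complex.ofRealCLM.hasDerivAt (x := ζ)).sub_const u
  rcases eq_or_ne w v with rfl | hwv
  · have hderiv : ∀ ζ : ℝ, HasDerivAt (fun ζ => -cauchyKernel w ζ)
        (cauchyKernel w ζ * cauchyKernel w ζ) ζ := fun ζ => by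
      refine HasDerivAt.congr_deriv ((hd w ζ).inv (ofReal_sub_ne_zero hw.ne' ζ)).neg ?_
      have h1 := ofReal_sub_ne_zero hw.ne' ζ
      simp only [cauchyKernel]
      field_simp
    rw [integral_of_hasDerivAt_of_tendsto hderiv hint
      ((tendsto_cauchyKernel w).mono_left hab).neg
      ((tendsto_cauchyKernel w).mono_left hat).neg, sub_self]
  · set q : ℝ → ℂ := fun ζ => ((ζ : ℂ) - w) * cauchyKernel v ζ with hq
    -- If `q` were real and nonpositive, imaginary parts in `ζ - w = q (ζ - v)` would give `Im w = q
    -- Im v ≤ 0`.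
    have hslit : ∀ ζ, q ζ ∈ Complex.slitPlane := by
      intro ζ
      by_contra h
      rw [Complex.mem_slitPlane_iff, not_or, not_not, not_lt] at h
      obtain ⟨hre, him⟩ := h
      have h2 := ofReal_sub_ne_zero hv.ne' ζ
      have h1 : (ζ : ℂ) - w = q ζ * ((ζ : ℂ) - v) := by
        simp only [hq, cauchyKernel]
        field_simp
      have h3 := congrArg Complex.im h1
      rw [Complex.mul_im, him] at h3
      simp at h3
      nlinarith
    have hlim : Tendsto (fun ζ => Complex.log (q ζ)) (cocompact ℝ) (𝓝 0) := by
      have h1 : Tendsto (fun ζ => 1 + (v - w) * cauchyKernel v ζ) (cocompact ℝ) (𝓝 1) := by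
        simpa using ((tendsto_cauchyKernel v).const_mul (v - w)).const_add 1
      have h2 : q = fun ζ => 1 + (v - w) * cauchyKernel v ζ := by
        ext ζ
        have h2 := ofReal_sub_ne_zero hv.ne' ζ
        simp only [hq, cauchyKernel]
        field_simp
        ring
      rw [← Complex.log_one]
      refine Tendsto.clog ?_ Complex.one_mem_slitPlane
      rw [h2]; exact h1
    have hderiv : ∀ ζ : ℝ, HasDerivAt (fun ζ => (w - v)⁻¹ * Complex.log (q ζ))
        (cauchyKernel w ζ * cauchyKernel v ζ) ζ := fun ζ => by
      have h1 := ofReal_sub_ne_zero hw.ne' ζ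
      have h2 := ofReal_sub_ne_zero hv.ne' ζ
      have h3 := sub_ne_zero.2 hwv
      have hqd : HasDerivAt q (1 * ((ζ : ℂ) - v)⁻¹ + ((ζ : ℂ) - w) * (-1 / ((ζ : ℂ) - v) ^ 2)) ζ :=
        (hd w ζ).mul ((hd v ζ).inv h2)
      refine HasDerivAt.congr_deriv ((hqd.clog_real (hslit ζ)).const_mul (w - v)⁻¹) ?_
      simp only [hq, cauchyKernel]
      field_simp
      ring
    have hb := (hlim.mono_left hab).const_mul (w - v)⁻¹
    have ht := (hlim.mono_left hat).const_mul (w - v)⁻¹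
    rw [integral_of_hasDerivAt_of_tendsto hderiv hint hb ht, sub_self]

/-- Square integrable complex functions on the line. -/
abbrev L2Line : Type := Lp ℂ 2 (volume : Measure ℝ)

/-- The Cauchy kernel as an element of `L²`. -/
def kernelL2 (w : ℂ) (hw : w.im ≠ 0) : L2Line := (memLp_two_cauchyKernel hw).toLp _

theorem coeFn_kernelL2 {w : ℂ} (hw : w.im ≠ 0) : kernelL2 w hw =ᵐ[volume] cauchyKernel w :=
  MemLp.coeFn_toLp _

theorem conj_im_ne_zero {w : ℂ} (hw : w.im ≠ 0) : ((starRingEnd ℂ) w).im ≠ 0 := by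
  simpa using hw

theorem inner_kernelL2 {w : ℂ} (hw : w.im ≠ 0) (f : L2Line) :
    inner ℂ (kernelL2 w hw) f = ∫ ζ : ℝ, cauchyKernel ((starRingEnd ℂ) w) ζ * f ζ := by
  rw [L2.inner_def]
  refine integral_congr_ae ?_
  filter_upwards [coeFn_kernelL2 hw] with ζ h
  rw [h, RCLike.inner_apply, conj_cauchyKernel, mul_comm]

theorem cauchyIntegral_eq_inner {w : ℂ} (hw : w.im ≠ 0) (f : L2Line) :
    cauchyIntegral f w = (2 * Real.pi * Complex.I)⁻¹ *
      inner ℂ (kernelL2 _ (conj_im_ne_zero hw)) f := by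
  rw [inner_kernelL2, cauchyIntegral]
  simp only [cauchyKernel, Complex.conj_conj, div_eq_inv_mul]

/-- The Hardy space of the upper half plane, as a closed subspace of `L²`. -/
def hardySpace : Submodule ℂ L2Line :=
  (Submodule.span ℂ {k | ∃ (w : ℂ) (hw : w.im ≠ 0), -1 < w.im ∧ w.im < 0 ∧
    k = kernelL2 w hw}).topologicalClosure

theorem isClosed_hardySpace : IsClosed (hardySpace : Set L2Line) :=
  Submodule.isClosed_topologicalClosure _

instance : CompleteSpace hardySpace := isClosed_hardySpace.completeSpace_coe

theorem kernelL2_mem_hardySpace {w : ℂ} (hw : w.im ≠ 0) (h1 : -1 < w.im) (h2 : w.im < 0) :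
    kernelL2 w hw ∈ hardySpace :=
  Submodule.le_topologicalClosure _ (Submodule.subset_span ⟨w, hw, h1, h2, rfl⟩)

/-- To be in a closed subspace on all of the Hardy space, it suffices to be so on kernels. -/
theorem map_mem_of_mem_hardySpace {V : Type*} [NormedAddCommGroup V] [NormedSpace ℂ V]
    {T : L2Line →L[ℂ] V} {W : Submodule ℂ V} (hW : IsClosed (W : Set V))
    (h : ∀ (w : ℂ) (hw : w.im ≠ 0), -1 < w.im → w.im < 0 → T (kernelL2 w hw) ∈ W)
    {f : L2Line} (hf : f ∈ hardySpace) : T f ∈ W := by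
  have hle : hardySpace ≤ W.comap (T : L2Line →ₗ[ℂ] V) := by
    refine Submodule.topologicalClosure_minimal _ (Submodule.span_le.2 ?_)
      (hW.preimage T.continuous)
    rintro _ ⟨w, hw, h1, h2, rfl⟩
    exact h w hw h1 h2
  exact hle hf

theorem mem_hardySpace_orthogonal {f : L2Line}
    (h : ∀ (w : ℂ) (hw : w.im ≠ 0), -1 < w.im → w.im < 0 → inner ℂ (kernelL2 w hw) f = 0) :
    f ∈ hardySpaceᗮ := by
  rw [Submodule.mem_orthogonal']
  intro u hu
  have := map_mem_of_mem_hardySpace (T := innerSL ℂ f) (W := ⊥)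
    (by simp) (fun w hw h1 h2 => by
      rw [Submodule.mem_bot, innerSL_apply_apply, inner_eq_zero_symm]
      exact h w hw h1 h2) hu
  simpa using this

theorem kernelL2_mem_hardySpace_orthogonal {w : ℂ} (hw : w.im ≠ 0) (h : 0 < w.im) :
    kernelL2 w hw ∈ hardySpaceᗮ := by
  refine mem_hardySpace_orthogonal fun v hv _ hv2 => ?_
  rw [inner_kernelL2, ← integral_cauchyKernel_mul_eq_zero
    (show 0 < ((starRingEnd ℂ) v).im by simpa using hv2) h]
  refine integral_congr_ae ?_
  filter_upwards [coeFn_kernelL2 hw] with ζ h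
  rw [h]

/-- The orthogonal projection onto the Hardy space of the upper half plane. -/
def projPlus : L2Line →L[ℂ] L2Line := hardySpace.starProjection

/-- The orthogonal projection onto the complement of the Hardy space of the upper half plane. -/
def projMinus : L2Line →L[ℂ] L2Line := hardySpaceᗮ.starProjection

theorem projPlus_add_projMinus (f : L2Line) : projPlus f + projMinus f = f :=
  Submodule.starProjection_add_starProjection_orthogonal f

/-- The kernel with pole in the upper half plane ignores the Hardy component of `f`, and the one
with pole in the lower half plane ignores the other component. Subtracting the latter is therefore
free, and the difference of the two is a multiple of the Poisson kernel. -/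
theorem inner_kernelL2_eq_inner_projMinus {w : ℂ} (hw : w.im ≠ 0) (h1 : -1 < w.im)
    (h2 : w.im < 0) (f : L2Line) :
    inner ℂ (kernelL2 _ (conj_im_ne_zero hw)) f =
      inner ℂ (kernelL2 _ (conj_im_ne_zero hw) - kernelL2 w hw) (projMinus f) := by
  have hc : kernelL2 _ (conj_im_ne_zero hw) ∈ hardySpaceᗮ :=
    kernelL2_mem_hardySpace_orthogonal _ (by simpa using h2)
  have h3 : inner ℂ (kernelL2 _ (conj_im_ne_zero hw)) (projPlus f) = 0 :=
    Submodule.inner_left_of_mem_orthogonal (K := hardySpace)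
      (Submodule.starProjection_apply_mem _ _) hc
  have h4 : inner ℂ (kernelL2 w hw) (projMinus f) = 0 :=
    Submodule.inner_right_of_mem_orthogonal (K := hardySpace)
      (kernelL2_mem_hardySpace hw h1 h2) (Submodule.starProjection_apply_mem _ _)
  conv_lhs => rw [← projPlus_add_projMinus f, inner_add_right, h3, zero_add]
  rw [inner_sub_left, h4, sub_zero]

theorem cauchyKernel_sub_conj {z ε : ℝ} (hε : 0 < ε) (ζ : ℝ) :
    cauchyKernel (z - Complex.I * ε) ζ - cauchyKernel (z + Complex.I * ε) ζ =
      -(2 * Complex.I) * ((ε / ((ζ - z) ^ 2 + ε ^ 2) : ℝ) : ℂ) := by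
  have h1 := ofReal_sub_ne_zero (w := z - Complex.I * ε) (by simpa using hε.ne') ζ
  have h2 := ofReal_sub_ne_zero (w := z + Complex.I * ε) (by simpa using hε.ne') ζ
  have h3 : (((ζ - z) ^ 2 + ε ^ 2 : ℝ) : ℂ) =
      ((ζ : ℂ) - (z - Complex.I * ε)) * ((ζ : ℂ) - (z + Complex.I * ε)) := by
    push_cast
    linear_combination (ε : ℂ) ^ 2 * Complex.I_sq
  rw [Complex.ofReal_div, h3]
  simp only [cauchyKernel]
  field_simp
  ring

/-- The limit defining `P⁻ f` exists almost everywhere, and `P⁻` is minus an orthogonal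
projection. -/
theorem ae_hasPlemeljMinusAt (f : L2Line) :
    ∀ᵐ z : ℝ, HasPlemeljMinusAt f z (-(projMinus f) z) := by
  filter_upwards [ae_tendsto_poisson (Lp.memLp (projMinus f))] with z hz
  have hz2 := hz.const_mul (-(Real.pi : ℂ)⁻¹)
  rw [← mul_assoc, neg_mul, inv_mul_cancel₀ (by exact_mod_cast Real.pi_ne_zero), neg_one_mul] at hz2
  refine hz2.congr' ?_
  -- Taking `ε < 1` keeps `z - iε` in the strip of poles that generates the Hardy space.
  filter_upwards [Ioo_mem_nhdsGT (zero_lt_one' ℝ)] with ε hε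
  have him : ((z : ℂ) - Complex.I * ε).im = -ε := by simp
  have hw : ((z : ℂ) - Complex.I * ε).im ≠ 0 := by rw [him]; exact neg_ne_zero.2 hε.1.ne'
  have hconj : (starRingEnd ℂ) ((z : ℂ) - Complex.I * ε) = z + Complex.I * ε := by simp
  rw [cauchyIntegral_eq_inner hw, inner_kernelL2_eq_inner_projMinus hw (by linarith [hε.2])
    (by linarith [hε.1]), inner_sub_left, inner_kernelL2, inner_kernelL2, ← integral_sub]
  · rw [Complex.conj_conj]
    simp only [hconj, ← sub_mul, cauchyKernel_sub_conj hε.1, mul_assoc]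
    rw [integral_const_mul, ← mul_assoc]
    congr 1
    have := Complex.I_ne_zero
    have : (Real.pi : ℂ) ≠ 0 := by exact_mod_cast Real.pi_ne_zero
    field_simp
  · rw [Complex.conj_conj]
    exact (memLp_two_cauchyKernel hw).integrable_mul (Lp.memLp _)
  · exact (memLp_two_cauchyKernel (conj_im_ne_zero hw)).integrable_mul (Lp.memLp _)

/-! ### Multiplication operators -/

/-- Multiplication by a bounded function, as an operator on `L²`. -/
def mulOp (B : ℝ → ℂ) (hB : MemLp B ∞ volume) : L2Line →L[ℂ] L2Line :=
  (ContinuousLinearMap.mul ℂ ℂ).holderL volume ∞ 2 2 (hB.toLp B)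

section mulOp

variable {A B : ℝ → ℂ} {hA : MemLp A ∞ volume} {hB : MemLp B ∞ volume}

theorem coeFn_mulOp (hB : MemLp B ∞ volume) (f : L2Line) :
    mulOp B hB f =ᵐ[volume] fun z => B z * f z := by
  filter_upwards [(ContinuousLinearMap.mul ℂ ℂ).coeFn_holder (r := 2) (hB.toLp B) f,
    hB.coeFn_toLp] with z h1 h2
  simp only [mulOp, ContinuousLinearMap.holderL_apply_apply]
  rw [h1, h2, ContinuousLinearMap.mul_apply']

theorem mulOp_apply_eq_iff {f g : L2Line} :
    mulOp B hB f = g ↔ ∀ᵐ z : ℝ, B z * f z = g z := by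
  rw [Lp.ext_iff]
  constructor
  · intro h
    filter_upwards [coeFn_mulOp hB f, h] with z h1 h2
    rw [← h1, h2]
  · intro h
    filter_upwards [coeFn_mulOp hB f, h] with z h1 h2
    rw [h1, h2]

theorem mulOp_congr (h : A =ᵐ[volume] B) : mulOp A hA = mulOp B hB := by
  ext1 f
  rw [mulOp_apply_eq_iff]
  filter_upwards [coeFn_mulOp hB f, h] with z h1 h2
  rw [h1, h2]

theorem norm_mulOp_apply_le {C : ℝ} (h : ∀ᵐ z : ℝ, ‖B z‖ ≤ C) (f : L2Line) :
    ‖mulOp B hB f‖ ≤ C * ‖f‖ := by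
  refine Lp.norm_le_mul_norm_of_ae_le_mul ?_
  filter_upwards [coeFn_mulOp hB f, h] with z h1 h2
  rw [h1, norm_mul]
  exact mul_le_mul_of_nonneg_right h2 (norm_nonneg _)

theorem inner_mulOp_left (hA : MemLp A ∞ volume) (hB : MemLp B ∞ volume)
    (h : ∀ z, B z = (starRingEnd ℂ) (A z)) (f g : L2Line) :
    inner ℂ (mulOp A hA f) g = inner ℂ f (mulOp B hB g) := by
  rw [L2.inner_def, L2.inner_def]
  refine integral_congr_ae ?_
  filter_upwards [coeFn_mulOp hA f, coeFn_mulOp hB g] with z h1 h2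
  simp only [h1, h2, RCLike.inner_apply, h, map_mul]
  ring

end mulOp

theorem memLp_top_cauchyKernel {w : ℂ} (hw : w.im ≠ 0) : MemLp (cauchyKernel w) ∞ volume :=
  memLp_top_of_bound (continuous_cauchyKernel hw).aestronglyMeasurable _
    (Eventually.of_forall (norm_cauchyKernel_le hw))

theorem memLp_top_onePoint (g : C(OnePoint ℝ, ℂ)) :
    MemLp (fun z : ℝ => g (z : OnePoint ℝ)) ∞ volume :=
  memLp_top_of_bound (g.continuous.comp OnePoint.continuous_coe).aestronglyMeasurable ‖g‖
    (Eventually.of_forall fun z => g.norm_coe_le_norm z)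

/-- The commutator of the projection with a multiplication operator. -/
def hankelComm (B : ℝ → ℂ) (hB : MemLp B ∞ volume) : L2Line →L[ℂ] L2Line :=
  projMinus ∘L mulOp B hB - mulOp B hB ∘L projMinus

theorem projMinus_of_mem {f : L2Line} (hf : f ∈ hardySpace) : projMinus f = 0 :=
  Submodule.starProjection_orthogonal_apply_eq_zero hf

theorem projMinus_projPlus (f : L2Line) : projMinus (projPlus f) = 0 :=
  projMinus_of_mem (Submodule.starProjection_apply_mem _ _)

/-- The diagonal blocks cancel: the commutator consists of the two Hankel blocks of the
multiplication operator. -/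
theorem hankelComm_eq (B : ℝ → ℂ) (hB : MemLp B ∞ volume) :
    hankelComm B hB = projMinus ∘L mulOp B hB ∘L projPlus
      - projPlus ∘L mulOp B hB ∘L projMinus := by
  ext1 f
  simp only [hankelComm, _root_.sub_apply, ContinuousLinearMap.comp_apply]
  have h1 : projMinus (mulOp B hB f) = projMinus (mulOp B hB (projPlus f)) +
      projMinus (mulOp B hB (projMinus f)) := by
    conv_lhs => rw [← projPlus_add_projMinus f, map_add, map_add]
  have h2 := projPlus_add_projMinus (mulOp B hB (projMinus f))
  rw [h1, sub_eq_sub_iff_add_eq_add, add_assoc, add_comm (projMinus _) (projPlus _), h2]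

theorem isCompactOperator_of_forall_mem {V W : Type*} [NormedAddCommGroup V] [NormedSpace ℂ V]
    [NormedAddCommGroup W] [NormedSpace ℂ W] (T : V →L[ℂ] W) (U : Submodule ℂ W)
    [FiniteDimensional ℂ U] (h : ∀ v, T v ∈ U) : IsCompactOperator T := by
  have : ProperSpace U := FiniteDimensional.proper ℂ U
  exact (isCompactOperator_of_locallyCompactSpace_dom (T.codRestrict U h)).clm_comp U.subtypeL

/-- Partial fractions: the product of the kernels at `w` and `v` is a multiple of their difference,
and `projMinus` kills the kernel at `v`. So the Hankel block has rank at most one. -/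
theorem projMinus_mulOp_cauchyKernel_mem {w : ℂ} (hw : w.im ≠ 0) (h1 : 1 ≤ |w.im|) (f : L2Line) :
    projMinus (mulOp _ (memLp_top_cauchyKernel hw) (projPlus f)) ∈
      Submodule.span ℂ {projMinus (kernelL2 w hw)} := by
  refine map_mem_of_mem_hardySpace
    (T := projMinus ∘L mulOp _ (memLp_top_cauchyKernel hw))
    (Submodule.closed_of_finiteDimensional _) (fun v hv hv1 hv2 => ?_)
    (Submodule.starProjection_apply_mem _ _)
  -- The generators have poles in the strip `-1 < Im v < 0`, so a symbol with `|Im w| ≥ 1` never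
  -- produces a double pole.
  have hne : w ≠ v := by
    rintro rfl
    rw [abs_of_neg hv2] at h1
    linarith
  have : mulOp _ (memLp_top_cauchyKernel hw) (kernelL2 v hv) =
      (w - v)⁻¹ • (kernelL2 w hw - kernelL2 v hv) := by
    rw [mulOp_apply_eq_iff]
    filter_upwards [coeFn_kernelL2 hw, coeFn_kernelL2 hv,
      Lp.coeFn_smul (w - v)⁻¹ (kernelL2 w hw - kernelL2 v hv),
      Lp.coeFn_sub (kernelL2 w hw) (kernelL2 v hv)] with ζ a1 a2 a3 a4
    rw [a3, Pi.smul_apply, a4, Pi.sub_apply, a1, a2, cauchyKernel_mul hw hv hne, smul_eq_mul]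
  rw [ContinuousLinearMap.comp_apply, this, map_smul, map_sub,
    projMinus_of_mem (kernelL2_mem_hardySpace hv hv1 hv2), sub_zero]
  exact Submodule.smul_mem _ _ (Submodule.mem_span_singleton_self _)

theorem isCompactOperator_hankelComm_cauchyKernel {w : ℂ} (hw : w.im ≠ 0) (h1 : 1 ≤ |w.im|) :
    IsCompactOperator (hankelComm _ (memLp_top_cauchyKernel hw)) := by
  have hw' := conj_im_ne_zero hw
  have h1' : 1 ≤ |((starRingEnd ℂ) w).im| := by simpa using h1
  set M := mulOp _ (memLp_top_cauchyKernel hw) with hM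
  set M' := mulOp _ (memLp_top_cauchyKernel hw') with hM'
  have hadj : ∀ f g, inner ℂ (projPlus (M (projMinus f))) g =
      inner ℂ f (projMinus (M' (projPlus g))) := by
    intro f g
    rw [projPlus, Submodule.inner_starProjection_left_eq_right, hM,
      inner_mulOp_left _ (memLp_top_cauchyKernel hw') (fun z => (conj_cauchyKernel w z).symm),
      projMinus, Submodule.inner_starProjection_left_eq_right]
  rw [hankelComm_eq]
  refine IsCompactOperator.sub (isCompactOperator_of_forall_mem _ _
    (projMinus_mulOp_cauchyKernel_mem hw h1)) ?_
  set U := Submodule.span ℂ {projMinus (kernelL2 _ hw')} with hU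
  -- By `hadj` the adjoint of this block is a Hankel block with conjugate symbol, with range in the
  -- line `U`; hence the block vanishes on `Uᗮ`.
  have hfac : ∀ f, projPlus (M (projMinus f)) = projPlus (M (projMinus (U.starProjection f))) := by
    intro f
    rw [← sub_eq_zero, ← map_sub, ← map_sub, ← map_sub, ← inner_self_eq_zero (𝕜 := ℂ), hadj]
    exact Submodule.inner_left_of_mem_orthogonal (K := U)
      (projMinus_mulOp_cauchyKernel_mem hw' h1' _) (Submodule.sub_starProjection_mem_orthogonal f)
  have hc : IsCompactOperator U.starProjection :=
    isCompactOperator_of_forall_mem _ U fun v => Submodule.starProjection_apply_mem _ _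
  have hT : (projPlus ∘L M ∘L projMinus : L2Line →L[ℂ] L2Line) =
      (projPlus ∘L M ∘L projMinus) ∘L U.starProjection := by
    ext1 f
    exact hfac f
  rw [hT]
  exact hc.clm_comp (projPlus ∘L M ∘L projMinus)

/-- The commutators with continuous functions on the compactified line. -/
def hankelCommL : C(OnePoint ℝ, ℂ) →L[ℂ] (L2Line →L[ℂ] L2Line) :=
  LinearMap.mkContinuous
    { toFun := fun g => hankelComm _ (memLp_top_onePoint g)
      map_add' := fun g h => by
        have : mulOp _ (memLp_top_onePoint (g + h)) =
            mulOp _ (memLp_top_onePoint g) + mulOp _ (memLp_top_onePoint h) := by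
          ext1 f
          rw [mulOp_apply_eq_iff, _root_.add_apply]
          filter_upwards [coeFn_mulOp (memLp_top_onePoint g) f,
            coeFn_mulOp (memLp_top_onePoint h) f, Lp.coeFn_add
              (mulOp _ (memLp_top_onePoint g) f) (mulOp _ (memLp_top_onePoint h) f)] with z a b c
          rw [c, Pi.add_apply, a, b, ContinuousMap.add_apply, add_mul]
        ext1 f
        simp only [hankelComm, this, _root_.sub_apply, _root_.add_apply,
          ContinuousLinearMap.comp_apply, map_add]
        abel
      map_smul' := fun c g => by
        have : mulOp _ (memLp_top_onePoint (c • g)) = c • mulOp _ (memLp_top_onePoint g) := by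
          ext1 f
          rw [mulOp_apply_eq_iff, _root_.smul_apply]
          filter_upwards [coeFn_mulOp (memLp_top_onePoint g) f,
            Lp.coeFn_smul c (mulOp _ (memLp_top_onePoint g) f)] with z a b
          rw [b, Pi.smul_apply, a, ContinuousMap.smul_apply, smul_eq_mul, smul_eq_mul, mul_assoc]
        ext1 f
        simp only [hankelComm, this, _root_.sub_apply,
          _root_.smul_apply, ContinuousLinearMap.comp_apply, map_smul, smul_sub,
          RingHom.id_apply] }
    2 fun g => by
      have hb : ∀ f, ‖mulOp _ (memLp_top_onePoint g) f‖ ≤ ‖g‖ * ‖f‖ :=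
        norm_mulOp_apply_le (Eventually.of_forall fun z => g.norm_coe_le_norm z)
      have hQ : ∀ f, ‖projMinus f‖ ≤ ‖f‖ := fun f => Submodule.norm_starProjection_apply_le _ f
      refine ContinuousLinearMap.opNorm_le_bound _ (by positivity) fun f => ?_
      change ‖projMinus (mulOp _ (memLp_top_onePoint g) f) -
        mulOp _ (memLp_top_onePoint g) (projMinus f)‖ ≤ _
      refine (norm_sub_le _ _).trans ?_
      have h1 := (hQ _).trans (hb f)
      have h2 := (hb (projMinus f)).trans (mul_le_mul_of_nonneg_left (hQ f) (norm_nonneg g))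
      linarith

theorem hankelCommL_apply (g : C(OnePoint ℝ, ℂ)) :
    hankelCommL g = hankelComm _ (memLp_top_onePoint g) := rfl

/-- The commutator is a derivation: `[Q, gh] = [Q, g] h + g [Q, h]`, and compact operators form an
ideal. -/
theorem isCompactOperator_hankelCommL_mul {g h : C(OnePoint ℝ, ℂ)}
    (hg : IsCompactOperator (hankelCommL g)) (hh : IsCompactOperator (hankelCommL h)) :
    IsCompactOperator (hankelCommL (g * h)) := by
  have hmul : ∀ f, mulOp _ (memLp_top_onePoint (g * h)) f =
      mulOp _ (memLp_top_onePoint g) (mulOp _ (memLp_top_onePoint h) f) := by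
    intro f
    rw [mulOp_apply_eq_iff]
    filter_upwards [coeFn_mulOp (memLp_top_onePoint h) f,
      coeFn_mulOp (memLp_top_onePoint g) (mulOp _ (memLp_top_onePoint h) f)] with z a b
    rw [b, a, ContinuousMap.mul_apply, mul_assoc]
  have : hankelCommL (g * h) = hankelCommL g ∘L mulOp _ (memLp_top_onePoint h) +
      mulOp _ (memLp_top_onePoint g) ∘L hankelCommL h := by
    ext1 f
    simp only [hankelCommL_apply, hankelComm, _root_.sub_apply,
      _root_.add_apply, ContinuousLinearMap.comp_apply, map_sub, hmul]
    abel
  rw [this]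
  exact (hg.comp_clm (mulOp _ (memLp_top_onePoint h))).add
    (hh.clm_comp (mulOp _ (memLp_top_onePoint g)))

theorem isCompactOperator_hankelCommL_algebraMap (c : ℂ) :
    IsCompactOperator (hankelCommL (algebraMap ℂ C(OnePoint ℝ, ℂ) c)) := by
  have hmul : ∀ f, mulOp _ (memLp_top_onePoint (algebraMap ℂ C(OnePoint ℝ, ℂ) c)) f = c • f := by
    intro f
    rw [mulOp_apply_eq_iff]
    filter_upwards [Lp.coeFn_smul c f] with z a
    rw [a]
    simp
  have : hankelCommL (algebraMap ℂ C(OnePoint ℝ, ℂ) c) = 0 := by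
    ext1 f
    simp only [hankelCommL_apply, hankelComm, _root_.sub_apply,
      ContinuousLinearMap.comp_apply, hmul, map_smul, sub_self, _root_.zero_apply]
  rw [this]
  exact isCompactOperator_zero

/-- The continuous functions on the compactified line whose commutators, and those of their
conjugates, are compact. -/
def compactCommAlgebra : StarSubalgebra ℂ C(OnePoint ℝ, ℂ) where
  carrier := {g | IsCompactOperator (hankelCommL g) ∧ IsCompactOperator (hankelCommL (star g))}
  mul_mem' {g h} hg hh := ⟨isCompactOperator_hankelCommL_mul hg.1 hh.1, by
    rw [star_mul]
    exact isCompactOperator_hankelCommL_mul hh.2 hg.2⟩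
  add_mem' {g h} hg hh := ⟨by rw [map_add]; exact hg.1.add hh.1, by
    rw [star_add, map_add]; exact hg.2.add hh.2⟩
  algebraMap_mem' c := ⟨isCompactOperator_hankelCommL_algebraMap c, by
    rw [← algebraMap_star_comm]; exact isCompactOperator_hankelCommL_algebraMap _⟩
  star_mem' {g} hg := ⟨hg.2, by rw [star_star]; exact hg.1⟩

theorem isClosed_compactCommAlgebra :
    IsClosed (compactCommAlgebra : Set C(OnePoint ℝ, ℂ)) := by
  have hc : IsClosed {T : L2Line →L[ℂ] L2Line | IsCompactOperator T} :=
    isClosed_setOfPred_isCompactOperator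
  exact (hc.preimage hankelCommL.continuous).inter
    (hc.preimage (hankelCommL.continuous.comp continuous_star))

/-- A Cauchy kernel as a continuous function on the compactified line. -/
def cauchyKernelOnePoint {w : ℂ} (hw : w.im ≠ 0) : C(OnePoint ℝ, ℂ) :=
  OnePoint.continuousMapMk ⟨cauchyKernel w, continuous_cauchyKernel hw⟩ 0 (by
    rw [coclosedCompact_eq_cocompact]; exact tendsto_cauchyKernel w)

theorem cauchyKernelOnePoint_mem {w : ℂ} (hw : w.im ≠ 0) (h1 : 1 ≤ |w.im|) :
    cauchyKernelOnePoint hw ∈ compactCommAlgebra := by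
  refine ⟨isCompactOperator_hankelComm_cauchyKernel hw h1, ?_⟩
  have h : hankelCommL (star (cauchyKernelOnePoint hw)) =
      hankelComm _ (memLp_top_cauchyKernel (conj_im_ne_zero hw)) := by
    have : mulOp _ (memLp_top_onePoint (star (cauchyKernelOnePoint hw))) =
        mulOp _ (memLp_top_cauchyKernel (conj_im_ne_zero hw)) :=
      mulOp_congr (Eventually.of_forall fun z => conj_cauchyKernel w z)
    rw [hankelCommL_apply, hankelComm, this, hankelComm]
  rw [h]
  exact isCompactOperator_hankelComm_cauchyKernel (conj_im_ne_zero hw) (by simpa using h1)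

/-- Stone–Weierstrass on the compactified line. The kernel at `i` alone separates points: it is
injective on the line and vanishes only at infinity. -/
theorem compactCommAlgebra_eq_top : compactCommAlgebra = ⊤ := by
  have hI : (Complex.I).im ≠ 0 := by simp
  have hsep : compactCommAlgebra.SeparatesPoints := by
    intro x y hxy
    refine ⟨cauchyKernelOnePoint hI, ⟨_, cauchyKernelOnePoint_mem hI (by simp), rfl⟩, ?_⟩
    have hne : ∀ z : ℝ, cauchyKernel Complex.I z ≠ 0 := fun z =>
      inv_ne_zero (ofReal_sub_ne_zero hI z)
    induction x using OnePoint.rec with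
    | infty =>
      induction y using OnePoint.rec with
      | infty => exact absurd rfl hxy
      | coe y => exact (hne y).symm
    | coe x =>
      induction y using OnePoint.rec with
      | infty => exact hne x
      | coe y =>
        intro h
        apply hxy
        have h2 := inv_injective h
        rw [sub_left_inj, Complex.ofReal_inj] at h2
        rw [h2]
  have h := ContinuousMap.starSubalgebra_topologicalClosure_eq_top_of_separatesPoints _ hsep
  refine top_le_iff.1 (h ▸ ?_)
  exact StarSubalgebra.topologicalClosure_minimal le_rfl isClosed_compactCommAlgebra

/-- Hankel operators whose symbol is continuous and vanishes at infinity are compact. -/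
theorem isCompactOperator_hankel {B : ℝ → ℂ} (hB : MemLp B ∞ volume) (hc : Continuous B)
    (h0 : Tendsto B (cocompact ℝ) (𝓝 0)) :
    IsCompactOperator (projMinus ∘L mulOp B hB ∘L projPlus) := by
  let g : C(OnePoint ℝ, ℂ) := OnePoint.continuousMapMk ⟨B, hc⟩ 0 (by
    rw [coclosedCompact_eq_cocompact]; exact h0)
  have hg : g ∈ compactCommAlgebra := compactCommAlgebra_eq_top ▸ StarSubalgebra.mem_top
  have : projMinus ∘L mulOp B hB ∘L projPlus = hankelComm B hB ∘L projPlus := by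
    ext1 f
    simp only [hankelComm, ContinuousLinearMap.comp_apply, _root_.sub_apply,
      projMinus_projPlus, map_zero, sub_zero]
  rw [this]
  exact hg.1.comp_clm projPlus

/-! ### Sobolev functions on the line are continuous and vanish at infinity -/

section Sobolev

open scoped FourierTransform ContDiff

theorem integral_fourierInv_mul {f g : ℝ → ℂ} (hf : Integrable f) (hg : Integrable g) :
    ∫ ξ, 𝓕⁻ f ξ * g ξ = ∫ x, f x * 𝓕⁻ g x := by
  have h := VectorFourier.integral_fourierIntegral_smul_eq_flip (L := -innerₗ ℝ)
    (μ := volume) (ν := volume) Real.continuous_fourierChar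
    (by simp; fun_prop) hf hg
  have hflip : (-innerₗ ℝ : ℝ →ₗ[ℝ] ℝ →ₗ[ℝ] ℝ).flip = -innerₗ ℝ := by
    ext
    simp
  rw [hflip] at h
  exact h

/-- A function in `H¹(ℝ)` agrees almost everywhere with a continuous function that vanishes at
infinity. -/
theorem MemH1.exists_continuous_ae_eq {r : ℝ → ℂ} (hr : MemH1 r) :
    ∃ r₀ : ℝ → ℂ, Continuous r₀ ∧ Tendsto r₀ (cocompact ℝ) (𝓝 0) ∧ r =ᵐ[volume] r₀ := by
  obtain ⟨h, hs⟩ := hr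
  -- Regularity 1 exceeds half the dimension, so the Fourier transform is an `L¹` function `v`. Its
  -- inverse transform is the continuous representative, and Riemann–Lebesgue gives the decay.
  obtain ⟨v, hv⟩ := hs.fourier_memL1 (by simp)
  have hvint : Integrable (v : ℝ → ℂ) := L1.integrable_coeFn v
  have hcont : Continuous (𝓕⁻ (v : ℝ → ℂ)) := by
    rw [← Real.Lp.coe_fourierTransformInv]
    exact (Real.Lp.fourierTransformInv v).continuous
  refine ⟨𝓕⁻ (v : ℝ → ℂ), hcont, ?_, ?_⟩
  · have h1 : 𝓕⁻ (v : ℝ → ℂ) = fun x => 𝓕 (v : ℝ → ℂ) (-x) :=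
      funext fun x => Real.fourierInv_eq_fourier_neg _ x
    rw [h1]
    exact (Real.zero_at_infty_fourier (v : ℝ → ℂ)).comp
      (Homeomorph.neg ℝ).isClosedEmbedding.tendsto_cocompact
  · have hloc : LocallyIntegrable r volume := h.locallyIntegrable (by norm_num)
    have hsub : LocallyIntegrable (fun x => r x - 𝓕⁻ (v : ℝ → ℂ) x) volume :=
      hloc.sub hcont.locallyIntegrable
    have hae := ae_eq_zero_of_integral_contDiff_smul_eq_zero hsub (fun g hg hgc => by
      have hg₁ : HasCompactSupport (Complex.ofRealCLM ∘ g) := hgc.comp_left rfl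
      have hg₂ : ContDiff ℝ ∞ (Complex.ofRealCLM ∘ g) := by fun_prop
      set φ : 𝓢(ℝ, ℂ) := hg₁.toSchwartzMap hg₂ with hφ
      have hφg : ∀ x, φ x = (g x : ℂ) := fun x => rfl
      have e1 : (Lp.toTemperedDistribution (h.toLp r)) φ =
          (Lp.toTemperedDistribution v) (𝓕⁻ φ) := by
        rw [← TemperedDistribution.fourierInv_apply, ← hv, FourierTransform.fourierInv_fourier_eq]
      rw [Lp.toTemperedDistribution_apply, Lp.toTemperedDistribution_apply] at e1
      simp only [smul_eq_mul, SchwartzMap.fourierInv_coe] at e1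
      rw [integral_fourierInv_mul φ.integrable hvint] at e1
      have e2 : ∫ x, φ x * (h.toLp r) x = ∫ x, φ x * r x :=
        integral_congr_ae (by filter_upwards [h.coeFn_toLp] with x hx; rw [hx])
      rw [e2] at e1
      simp only [hφg] at e1
      have i1 : Integrable fun x => (g x : ℂ) * r x := by
        simpa using hloc.integrable_smul_left_of_hasCompactSupport hg.continuous hgc
      have i2 : Integrable fun x => (g x : ℂ) * 𝓕⁻ (v : ℝ → ℂ) x := by
        simpa using hcont.locallyIntegrable.integrable_smul_left_of_hasCompactSupport
          hg.continuous hgc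
      simp only [Complex.real_smul, mul_sub]
      rw [integral_sub i1 i2, e1, sub_self])
    filter_upwards [hae] with x hx
    exact sub_eq_zero.1 hx

end Sobolev

/-! ### Uniqueness in the Hardy space -/

theorem Lp_norm_sq_eq_integral {E : Type*} [NormedAddCommGroup E]
    (f : Lp E 2 (volume : Measure ℝ)) : ‖f‖ ^ 2 = ∫ z : ℝ, ‖f z‖ ^ 2 := by
  have h := (Lp.memLp f).eLpNorm_eq_integral_rpow_norm two_ne_zero ENNReal.ofNat_ne_top
  rw [Lp.norm_def, h, ENNReal.toReal_ofReal (by positivity)]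
  simp only [ENNReal.toReal_ofNat, Real.rpow_ofNat]
  rw [← Real.rpow_natCast, ← Real.rpow_mul (integral_nonneg fun z => by positivity)]
  norm_num

theorem differentiableAt_integral_cauchyKernel {f : ℝ → ℂ} (hf : Integrable f) {N : ℝ}
    (h0 : ∀ᵐ ζ : ℝ, N < |ζ| → f ζ = 0) {U : Set ℂ} (hU : IsOpen U)
    (hNU : ∀ ζ : ℝ, |ζ| ≤ N → (ζ : ℂ) ∉ U) {w : ℂ} (hw : w ∈ U) :
    DifferentiableAt ℂ (fun w => ∫ ζ : ℝ, cauchyKernel w ζ * f ζ) w := by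
  obtain ⟨δ, hδ, hball⟩ := Metric.isOpen_iff.1 hU w hw
  have hfar : ∀ ζ : ℝ, |ζ| ≤ N → ∀ v ∈ Metric.ball w (δ / 2), δ / 2 ≤ ‖(ζ : ℂ) - v‖ := by
    intro ζ hζ v hv
    have h1 : δ ≤ ‖(ζ : ℂ) - w‖ := by
      by_contra h
      exact hNU ζ hζ (hball (by simpa [Complex.dist_eq] using h))
    have h2 : ‖v - w‖ < δ / 2 := by simpa [Complex.dist_eq] using hv
    have h3 := norm_sub_le_norm_sub_add_norm_sub (ζ : ℂ) v w
    linarith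
  have hmeas : ∀ v : ℂ, AEStronglyMeasurable (fun ζ => cauchyKernel v ζ * f ζ) volume := fun v =>
    ((Measurable.inv (by fun_prop)).aestronglyMeasurable).mul hf.aestronglyMeasurable
  have hbd : ∀ᵐ ζ : ℝ, ∀ v ∈ Metric.ball w (δ / 2), ‖cauchyKernel v ζ * f ζ‖ ≤
      (δ / 2)⁻¹ * ‖f ζ‖ := by
    filter_upwards [h0] with ζ hζ v hv
    rcases lt_or_ge N |ζ| with h | h
    · simp [hζ h]
    · rw [norm_mul, cauchyKernel, norm_inv]
      exact mul_le_mul_of_nonneg_right (inv_anti₀ (by positivity) (hfar ζ h v hv)) (norm_nonneg _)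
  refine (hasDerivAt_integral_of_dominated_loc_of_deriv_le (μ := volume)
    (F := fun w ζ => cauchyKernel w ζ * f ζ)
    (F' := fun w ζ => cauchyKernel w ζ ^ 2 * f ζ) (bound := fun ζ => (δ / 2)⁻¹ ^ 2 * ‖f ζ‖)
    (Metric.ball_mem_nhds w (half_pos hδ)) (Eventually.of_forall hmeas) ?_ ?_ ?_
    (hf.norm.const_mul _) ?_).2.differentiableAt
  · refine (hf.norm.const_mul (δ / 2)⁻¹).mono' (hmeas w) ?_
    filter_upwards [hbd] with ζ hζ
    exact hζ w (Metric.mem_ball_self (half_pos hδ))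
  · exact (((Measurable.inv (by fun_prop)).pow_const 2).aestronglyMeasurable).mul
      hf.aestronglyMeasurable
  · filter_upwards [h0] with ζ hζ v hv
    rcases lt_or_ge N |ζ| with h | h
    · simp [hζ h]
    · rw [norm_mul, cauchyKernel, norm_pow, norm_inv]
      refine mul_le_mul_of_nonneg_right ?_ (norm_nonneg _)
      exact pow_le_pow_left₀ (by positivity) (inv_anti₀ (by positivity) (hfar ζ h v hv)) 2
  · filter_upwards [h0] with ζ hζ v hv
    rcases lt_or_ge N |ζ| with h | h
    · simpa [hζ h] using hasDerivAt_const v (0 : ℂ)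
    · have hne : (ζ : ℂ) - v ≠ 0 := by
        rw [← norm_pos_iff]
        exact (half_pos hδ).trans_le (hfar ζ h v hv)
      refine HasDerivAt.congr_deriv
        ((((hasDerivAt_id v).const_sub (ζ : ℂ)).inv hne).mul_const (f ζ)) ?_
      simp only [cauchyKernel]
      have : ((ζ : ℂ) - v) ^ 2 ≠ 0 := pow_ne_zero 2 hne
      simp

/-- An element of the Hardy space that vanishes outside a bounded set is zero. -/
theorem eq_zero_of_mem_hardySpace_of_ae_eq_zero {f : L2Line} (hf : f ∈ hardySpace) {N : ℝ}
    (h0 : ∀ᵐ ζ : ℝ, N < |ζ| → f ζ = 0) : f = 0 := by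
  have hint : Integrable f := by
    have h1 : IntegrableOn f (Metric.closedBall 0 N) :=
      ((Lp.memLp f).locallyIntegrable (by norm_num)).integrableOn_isCompact
        (isCompact_closedBall _ _)
    refine h1.integrable_of_ae_notMem_eq_zero ?_
    filter_upwards [h0] with ζ hζ hn
    exact hζ (by simpa using hn)
  set G : ℂ → ℂ := fun w => ∫ ζ : ℝ, cauchyKernel w ζ * f ζ with hG
  have hinner : ∀ (w : ℂ) (hw : w.im ≠ 0), inner ℂ (kernelL2 w hw) f = G ((starRingEnd ℂ) w) :=
    fun w hw => inner_kernelL2 hw f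
  -- The Cauchy transform `G` is analytic off `[-N, N]`. It vanishes on `U₁` because `f` is in the
  -- Hardy space, and `U₂` bridges `U₁` and `U₃`, so it vanishes on `U₃` too. That makes `f`
  -- orthogonal to the Hardy space.
  set U₁ : Set ℂ := {w | w.im < 0}
  set U₂ : Set ℂ := {w | N < w.re}
  set U₃ : Set ℂ := {w | 0 < w.im}
  have ho₁ : IsOpen U₁ := isOpen_lt Complex.continuous_im continuous_const
  have ho₂ : IsOpen U₂ := isOpen_lt continuous_const Complex.continuous_re
  have ho₃ : IsOpen U₃ := isOpen_lt continuous_const Complex.continuous_im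
  have hU : IsOpen (U₁ ∪ U₂ ∪ U₃) := (ho₁.union ho₂).union ho₃
  have hp : IsPreconnected (U₁ ∪ U₂ ∪ U₃) := by
    have c₁ : IsPreconnected U₁ := (convex_halfSpace_im_lt 0).isPreconnected
    have c₂ : IsPreconnected U₂ := (convex_halfSpace_re_gt N).isPreconnected
    have c₃ : IsPreconnected U₃ := (convex_halfSpace_im_gt 0).isPreconnected
    refine IsPreconnected.union (⟨N + 1, 1⟩ : ℂ) (Or.inr ?_) ?_
      (IsPreconnected.union (⟨N + 1, -1⟩ : ℂ) ?_ ?_ c₁ c₂) c₃ <;> simp [U₁, U₂, U₃]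
  have han : AnalyticOnNhd ℂ G (U₁ ∪ U₂ ∪ U₃) := by
    refine DifferentiableOn.analyticOnNhd (fun w hw =>
      (differentiableAt_integral_cauchyKernel hint h0 hU ?_ hw).differentiableWithinAt) hU
    intro ζ hζ h
    have := le_abs_self ζ
    simp only [U₁, U₂, U₃, Set.mem_union, Set.mem_ofPred_eq, Complex.ofReal_im, Complex.ofReal_re,
      lt_irrefl, false_or, or_false] at h
    linarith
  have hzero : Set.EqOn G 0 (U₁ ∪ U₂ ∪ U₃) := by
    refine han.eqOn_zero_of_preconnected_of_eventuallyEq_zero hp (z₀ := ⟨0, -(1 / 2)⟩)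
      (Or.inl (Or.inl (by simp [U₁]))) ?_
    have hopen : IsOpen {w : ℂ | -1 < w.im ∧ w.im < 0} :=
      (isOpen_lt continuous_const Complex.continuous_im).inter ho₁
    filter_upwards [hopen.mem_nhds (show (⟨0, -(1 / 2)⟩ : ℂ) ∈ _ by constructor <;> norm_num)]
      with w hw
    have hw0 : ((starRingEnd ℂ) w).im ≠ 0 := by simpa using hw.2.ne
    have h1 := hinner _ hw0
    rw [Complex.conj_conj] at h1
    rw [← h1]
    exact Submodule.inner_left_of_mem_orthogonal (K := hardySpace) hf
      (kernelL2_mem_hardySpace_orthogonal hw0 (by simpa using hw.2))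
  have horth : f ∈ hardySpaceᗮ := mem_hardySpace_orthogonal fun w hw _ h2 => by
    rw [hinner]
    exact hzero (Or.inr (by simpa [U₃] using h2))
  exact inner_self_eq_zero.1 (Submodule.inner_right_of_mem_orthogonal (K := hardySpace) hf horth)

/-! ### The scalar system -/

/-- The composition `P M_A Q M_B` of projections and multiplication operators. -/
def toeplitzComp (A B : L2Line →L[ℂ] L2Line) : L2Line →L[ℂ] L2Line :=
  projPlus ∘L A ∘L projMinus ∘L B

theorem norm_projPlus_apply_le (f : L2Line) : ‖projPlus f‖ ≤ ‖f‖ :=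
  Submodule.norm_starProjection_apply_le _ f

theorem norm_projMinus_apply_le (f : L2Line) : ‖projMinus f‖ ≤ ‖f‖ :=
  Submodule.norm_starProjection_apply_le _ f

theorem norm_toeplitzComp_apply_le {A B : L2Line →L[ℂ] L2Line} {α β : ℝ} (hα : 0 ≤ α)
    (hA : ∀ f, ‖A f‖ ≤ α * ‖f‖) (hB : ∀ f, ‖B f‖ ≤ β * ‖f‖) (f : L2Line) :
    ‖toeplitzComp A B f‖ ≤ α * β * ‖f‖ :=
  calc ‖toeplitzComp A B f‖ ≤ ‖A (projMinus (B f))‖ := norm_projPlus_apply_le _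
    _ ≤ α * ‖projMinus (B f)‖ := hA _
    _ ≤ α * (β * ‖f‖) :=
      mul_le_mul_of_nonneg_left ((norm_projMinus_apply_le _).trans (hB f)) hα
    _ = α * β * ‖f‖ := by ring

/-- The integral of `(1 - |B|²)|f|²` has a nonnegative integrand and is at most 0. -/
theorem ae_eq_zero_of_norm_le_norm_mulOp {B : ℝ → ℂ} {hB : MemLp B ∞ volume}
    (h1 : ∀ᵐ z : ℝ, ‖B z‖ ≤ 1) {f : L2Line} (h : ‖f‖ ≤ ‖mulOp B hB f‖) :
    ∀ᵐ z : ℝ, ‖B z‖ < 1 → f z = 0 := by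
  have hfi : Integrable fun z => ‖f z‖ ^ 2 := (Lp.memLp f).integrable_norm_pow two_ne_zero
  have hBi : Integrable fun z => ‖mulOp B hB f z‖ ^ 2 :=
    (Lp.memLp (mulOp B hB f)).integrable_norm_pow two_ne_zero
  have hnn : 0 ≤ᵐ[volume] fun z => ‖f z‖ ^ 2 - ‖mulOp B hB f z‖ ^ 2 := by
    filter_upwards [h1, coeFn_mulOp hB f] with z hz hz2
    rw [hz2, Pi.zero_apply, norm_mul, mul_pow]
    have : ‖B z‖ ^ 2 ≤ 1 := pow_le_one₀ (norm_nonneg _) hz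
    nlinarith [sq_nonneg ‖f z‖]
  have hle : ∫ z, (‖f z‖ ^ 2 - ‖mulOp B hB f z‖ ^ 2) ≤ 0 := by
    rw [integral_sub hfi hBi, ← Lp_norm_sq_eq_integral, ← Lp_norm_sq_eq_integral, sub_nonpos]
    exact pow_le_pow_left₀ (norm_nonneg _) h 2
  have heq := (integral_eq_zero_iff_of_nonneg_ae hnn (hfi.sub hBi)).1
    (le_antisymm hle (integral_nonneg_of_ae hnn))
  filter_upwards [heq, coeFn_mulOp hB f] with z hz hz2 hlt
  rw [hz2, Pi.zero_apply, norm_mul, mul_pow] at hz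
  by_contra hne
  have h3 : 0 < ‖f z‖ ^ 2 := by positivity
  have h4 : ‖B z‖ ^ 2 < 1 := pow_lt_one₀ (norm_nonneg _) hlt two_ne_zero
  nlinarith

theorem eq_zero_of_add_toeplitzComp_eq_zero {A : L2Line →L[ℂ] L2Line} (hA : ∀ f, ‖A f‖ ≤ ‖f‖)
    {B : ℝ → ℂ} (hB : MemLp B ∞ volume) (h1 : ∀ᵐ z : ℝ, ‖B z‖ ≤ 1)
    (h0 : Tendsto B (cocompact ℝ) (𝓝 0)) {b : L2Line}
    (hb : b + toeplitzComp A (mulOp B hB) b = 0) : b = 0 := by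
  have hb' : b = -toeplitzComp A (mulOp B hB) b := eq_neg_of_add_eq_zero_left hb
  have hmem : b ∈ hardySpace := by
    rw [hb']
    exact neg_mem (Submodule.starProjection_apply_mem _ _)
  have hnorm : ‖b‖ ≤ ‖mulOp B hB b‖ :=
    calc ‖b‖ = ‖toeplitzComp A (mulOp B hB) b‖ := by conv_lhs => rw [hb', norm_neg]
      _ ≤ ‖A (projMinus (mulOp B hB b))‖ := norm_projPlus_apply_le _
      _ ≤ ‖projMinus (mulOp B hB b)‖ := hA _
      _ ≤ ‖mulOp B hB b‖ := norm_projMinus_apply_le _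
  have hev : ∀ᶠ z in cocompact ℝ, ‖B z‖ < 1 := by
    have := h0.norm
    rw [norm_zero] at this
    exact (tendsto_order.1 this).2 1 one_pos
  obtain ⟨N, hN⟩ : ∃ N : ℝ, ∀ z : ℝ, N < |z| → ‖B z‖ < 1 := by
    rw [← Metric.cobounded_eq_cocompact] at hev
    obtain ⟨N, -, hN⟩ :=
      (Metric.hasBasis_cobounded_compl_closedBall (0 : ℝ)).eventually_iff.1 hev
    exact ⟨N, fun z hz => hN (by simpa using hz)⟩
  refine eq_zero_of_mem_hardySpace_of_ae_eq_zero hmem (N := N) ?_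
  filter_upwards [ae_eq_zero_of_norm_le_norm_mulOp h1 hnorm] with z hz hz2
  exact hz (hN z hz2)

theorem exists_add_eq_of_isCompactOperator {V : Type*} [NormedAddCommGroup V] [NormedSpace ℂ V]
    [CompleteSpace V] {T : V →L[ℂ] V} (hT : IsCompactOperator T)
    (hinj : ∀ v, v + T v = 0 → v = 0) (g : V) : ∃ v, v + T v = g := by
  rcases hT.hasEigenvalue_or_mem_resolventSet (μ := -1) (by norm_num) with h | h
  · obtain ⟨v, hv⟩ := h.exists_hasEigenvector
    refine absurd (hinj v ?_) hv.2
    have : T v = -v := by simpa using hv.apply_eq_smul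
    rw [this, add_neg_cancel]
  · obtain ⟨u, hu⟩ := h
    -- The unit `u` is `-1 - T`, hence the sign.
    refine ⟨-(u⁻¹ : (V →L[ℂ] V)ˣ).val g, ?_⟩
    have h1 : (u : V →L[ℂ] V) ((u⁻¹ : (V →L[ℂ] V)ˣ).val g) = g := by
      change ((u : V →L[ℂ] V) * (u⁻¹ : (V →L[ℂ] V)ˣ).val) g = g
      rw [Units.mul_inv]
      rfl
    rw [hu] at h1
    simp only [Algebra.algebraMap_eq_smul_one, _root_.sub_apply, _root_.smul_apply,
      one_apply_eq_self] at h1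
    rw [map_neg]
    conv_rhs => rw [← h1]
    module

theorem exists_add_toeplitzComp_eq {A : L2Line →L[ℂ] L2Line} (hA : ∀ f, ‖A f‖ ≤ ‖f‖)
    {B : ℝ → ℂ} (hB : MemLp B ∞ volume) (h1 : ∀ᵐ z : ℝ, ‖B z‖ ≤ 1) (hc : Continuous B)
    (h0 : Tendsto B (cocompact ℝ) (𝓝 0)) (g : L2Line) :
    ∃ b, b + toeplitzComp A (mulOp B hB) b = g := by
  set K := toeplitzComp A (mulOp B hB) with hK
  have hrange : ∀ f, projPlus (K f) = K f := fun f =>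
    Submodule.starProjection_eq_self_iff.2 (Submodule.starProjection_apply_mem _ _)
  -- Only after restriction to the Hardy space does `K` contain the Hankel operator `QBP`, so
  -- compactness is claimed for `K ∘L projPlus`.
  have hcomp : IsCompactOperator (K ∘L projPlus) :=
    (isCompactOperator_hankel hB hc h0).clm_comp (projPlus ∘L A)
  -- With a right-hand side in the range of `K`, the solution lies in the Hardy space, so `projPlus`
  -- can be dropped from the equation.
  have hfix : ∀ {u c : L2Line}, c + K (projPlus c) = K u → projPlus c = c := by
    intro u c h
    have : c = K (u - projPlus c) := by rw [map_sub, ← h, add_sub_cancel_right]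
    rw [this, hrange]
  -- Looking for `b = g + c` replaces the arbitrary right-hand side `g` by `-Kg`, which lies in the
  -- range of `K`.
  obtain ⟨c, hc⟩ := exists_add_eq_of_isCompactOperator hcomp (fun c h => by
    have h' : c + K (projPlus c) = K 0 := by rw [map_zero]; exact h
    refine eq_zero_of_add_toeplitzComp_eq_zero hA hB h1 h0 ?_
    have h2 := hfix h'
    rwa [h2, map_zero] at h') (K (-g))
  have hc' : c + K (projPlus c) = K (-g) := hc
  rw [hfix hc'] at hc'
  refine ⟨g + c, ?_⟩
  rw [map_add, map_neg] at *
  rw [show g + c + (K g + K c) = g + (c + K c + K g) by abel, hc', neg_add_cancel, add_zero]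

/-- The pair `(a, b)` solves the singular integral equation with jump factors `A` and `B` and
right-hand side `(f, g)`. -/
def SolvesRow (A B : L2Line →L[ℂ] L2Line) (a b f g : L2Line) : Prop :=
  a + projMinus (B (A a + b)) = f ∧ b + projMinus (A a) = g

/-- With `s = Aa + b`, the second equation says `s = g + PAa`; inserting `a = f - QBs` leaves an
equation in `s` alone. Conversely `s` determines `a`, and then `b = s - Aa`. -/
theorem solvesRow_iff {A B : L2Line →L[ℂ] L2Line} {a b f g : L2Line} :
    SolvesRow A B a b f g ↔ a = f - projMinus (B (A a + b)) ∧
      (A a + b) + toeplitzComp A B (A a + b) = g + projPlus (A f) := by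
  rw [SolvesRow, ← eq_sub_iff_add_eq]
  refine and_congr_right fun ha => ?_
  have h1 : toeplitzComp A B (A a + b) = projPlus (A f) - projPlus (A a) := by
    rw [← map_sub, ← map_sub]
    change projPlus (A (projMinus (B (A a + b)))) = _
    congr 2
    conv_rhs => rw [ha]
    abel
  have h2 := projPlus_add_projMinus (A a)
  rw [h1]
  constructor
  · intro h
    rw [← h]
    nth_rewrite 1 [← h2]
    abel
  · intro h
    have h3 : b + projMinus (A a) = (A a + b + (projPlus (A f) - projPlus (A a))) -
        projPlus (A f) := by
      nth_rewrite 2 [← h2]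
      abel
    rw [h3, h, add_sub_cancel_right]

theorem SolvesRow.norm_le {A B : L2Line →L[ℂ] L2Line} {a b f g : L2Line} {α β : ℝ}
    (hα : 0 ≤ α) (hα1 : α ≤ 1) (hβ1 : β ≤ 1) (hαβ : α * β < 1)
    (hA : ∀ f, ‖A f‖ ≤ α * ‖f‖) (hB : ∀ f, ‖B f‖ ≤ β * ‖f‖) (h : SolvesRow A B a b f g) :
    ‖a‖ ^ 2 + ‖b‖ ^ 2 ≤ (6 * (1 + (1 - α * β)⁻¹)) ^ 2 * (‖f‖ ^ 2 + ‖g‖ ^ 2) := by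
  obtain ⟨h1, h2⟩ := solvesRow_iff.1 h
  set s := A a + b with hs
  have hA1 : ∀ u, ‖A u‖ ≤ ‖u‖ := fun u =>
    (hA u).trans (mul_le_of_le_one_left (norm_nonneg u) hα1)
  have hB1 : ∀ u, ‖B u‖ ≤ ‖u‖ := fun u =>
    (hB u).trans (mul_le_of_le_one_left (norm_nonneg u) hβ1)
  set t := (1 - α * β)⁻¹ with ht
  have hpos : 0 < 1 - α * β := sub_pos.2 hαβ
  have ht0 : 0 < t := inv_pos.2 hpos
  have hsn : ‖s‖ ≤ t * (‖f‖ + ‖g‖) := by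
    rw [ht, inv_mul_eq_div, le_div_iff₀ hpos]
    have e1 : s = g + projPlus (A f) - toeplitzComp A B s := by rw [← h2, add_sub_cancel_right]
    have e2 : ‖s‖ ≤ ‖g‖ + ‖f‖ + α * β * ‖s‖ :=
      calc ‖s‖ = ‖g + projPlus (A f) - toeplitzComp A B s‖ := by rw [← e1]
        _ ≤ ‖g‖ + ‖projPlus (A f)‖ + ‖toeplitzComp A B s‖ :=
          (norm_sub_le _ _).trans (by gcongr; exact norm_add_le _ _)
        _ ≤ _ := by
          gcongr
          · exact (norm_projPlus_apply_le _).trans (hA1 f)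
          · exact norm_toeplitzComp_apply_le hα hA hB s
    linarith
  have han : ‖a‖ ≤ ‖f‖ + ‖s‖ := by
    rw [h1]
    exact (norm_sub_le _ _).trans (by
      gcongr; exact (norm_projMinus_apply_le _).trans (hB1 s))
  have hbn : ‖b‖ ≤ ‖s‖ + ‖a‖ := by
    have : b = s - A a := by rw [hs, add_sub_cancel_left]
    rw [this]
    exact (norm_sub_le _ _).trans (by gcongr; exact hA1 a)
  -- Here `‖a‖ + ‖b‖ ≤ 2‖f‖ + 3‖s‖`. The later factor 4 from squaring `‖f‖ + ‖g‖` turns 3 into the 6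
  -- of the statement.
  have hsum : ‖a‖ + ‖b‖ ≤ 3 * (1 + t) * (‖f‖ + ‖g‖) := by
    nlinarith [norm_nonneg f, norm_nonneg g]
  have hsq : (‖a‖ + ‖b‖) ^ 2 ≤ (3 * (1 + t) * (‖f‖ + ‖g‖)) ^ 2 :=
    pow_le_pow_left₀ (by positivity) hsum 2
  have h3 : (‖f‖ + ‖g‖) ^ 2 ≤ 4 * (‖f‖ ^ 2 + ‖g‖ ^ 2) := by
    nlinarith [sq_nonneg (‖f‖ - ‖g‖), sq_nonneg ‖f‖, sq_nonneg ‖g‖]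
  have h4 : ‖a‖ ^ 2 + ‖b‖ ^ 2 ≤ (‖a‖ + ‖b‖) ^ 2 := by
    nlinarith [mul_nonneg (norm_nonneg a) (norm_nonneg b)]
  calc ‖a‖ ^ 2 + ‖b‖ ^ 2 ≤ (3 * (1 + t)) ^ 2 * (‖f‖ + ‖g‖) ^ 2 := by
        rw [← mul_pow]; exact h4.trans hsq
    _ ≤ (3 * (1 + t)) ^ 2 * (4 * (‖f‖ ^ 2 + ‖g‖ ^ 2)) := by gcongr
    _ = _ := by ring

section solvability

variable {A : L2Line →L[ℂ] L2Line} {B : ℝ → ℂ} {hB : MemLp B ∞ volume}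

theorem SolvesRow.eq_zero (hA : ∀ f, ‖A f‖ ≤ ‖f‖) (h1 : ∀ᵐ z : ℝ, ‖B z‖ ≤ 1)
    (h0 : Tendsto B (cocompact ℝ) (𝓝 0)) {a b : L2Line}
    (h : SolvesRow A (mulOp B hB) a b 0 0) : a = 0 ∧ b = 0 := by
  obtain ⟨e1, e2⟩ := solvesRow_iff.1 h
  rw [map_zero, map_zero, add_zero] at e2
  have e3 := eq_zero_of_add_toeplitzComp_eq_zero hA hB h1 h0 e2
  rw [e3, map_zero, map_zero, sub_zero] at e1
  rw [e1, map_zero, zero_add] at e3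
  exact ⟨e1, e3⟩

theorem exists_solvesRow (hA : ∀ f, ‖A f‖ ≤ ‖f‖) (h1 : ∀ᵐ z : ℝ, ‖B z‖ ≤ 1)
    (hc : Continuous B) (h0 : Tendsto B (cocompact ℝ) (𝓝 0)) (f g : L2Line) :
    ∃ a b, SolvesRow A (mulOp B hB) a b f g := by
  obtain ⟨s, hs⟩ := exists_add_toeplitzComp_eq hA hB h1 hc h0 (g + projPlus (A f))
  set a := f - projMinus (mulOp B hB s) with ha
  refine ⟨a, s - A a, solvesRow_iff.2 ?_⟩
  rw [add_sub_cancel]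
  exact ⟨ha, hs⟩

end solvability

/-! ### Matrix valued functions -/

theorem frobenius_norm_sq {m : ℕ} (M : Matrix (Fin m) (Fin 2) ℂ) :
    ‖M‖ ^ 2 = ∑ i, ∑ j, ‖M i j‖ ^ 2 := by
  rw [Matrix.frobenius_norm_def, ← Real.rpow_natCast, ← Real.rpow_mul
    (Finset.sum_nonneg fun i _ => Finset.sum_nonneg fun j _ => by positivity)]
  norm_num

theorem norm_entry_le {m : ℕ} (M : Matrix (Fin m) (Fin 2) ℂ) (i : Fin m) (j : Fin 2) :
    ‖M i j‖ ≤ ‖M‖ := by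
  refine pow_le_pow_iff_left₀ (norm_nonneg _) (norm_nonneg _) two_ne_zero |>.1 ?_
  rw [frobenius_norm_sq]
  exact (Finset.single_le_sum (f := fun j => ‖M i j‖ ^ 2) (fun j _ => by positivity)
    (Finset.mem_univ j)).trans
    (Finset.single_le_sum (f := fun i => ∑ j, ‖M i j‖ ^ 2)
      (fun i _ => Finset.sum_nonneg fun j _ => by positivity) (Finset.mem_univ i))

/-- The `(i, j)` entry of a matrix valued `L²` function. -/
def entryL {m : ℕ} (i : Fin m) (j : Fin 2) : L2Mat m →L[ℂ] L2Line :=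
  ((Matrix.entryLinearMap ℂ ℂ i j).mkContinuous 1 fun M => by
    simpa using norm_entry_le M i j).compLpL 2 volume

/-- The matrix valued `L²` function with a given `(i, j)` entry and zeros elsewhere. -/
def singleL {m : ℕ} (i : Fin m) (j : Fin 2) : L2Line →L[ℂ] L2Mat m :=
  ((Matrix.singleLinearMap ℂ i j : ℂ →ₗ[ℂ] Matrix (Fin m) (Fin 2) ℂ).mkContinuous 1
    fun c => by
      refine pow_le_pow_iff_left₀ (norm_nonneg _) (by positivity) two_ne_zero |>.1 ?_
      rw [frobenius_norm_sq]
      simp [Matrix.single_apply, apply_ite norm, ite_pow, Finset.sum_ite_eq, ite_and]).compLpL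
    2 volume

variable {m : ℕ}

theorem coeFn_entryL (i : Fin m) (j : Fin 2) (Ψ : L2Mat m) :
    entryL i j Ψ =ᵐ[volume] fun z => Ψ z i j :=
  ContinuousLinearMap.coeFn_compLpL _ _

theorem coeFn_singleL (i : Fin m) (j : Fin 2) (f : L2Line) :
    singleL i j f =ᵐ[volume] fun z => Matrix.single i j (f z) :=
  ContinuousLinearMap.coeFn_compLpL _ _

theorem entryL_singleL (i i' : Fin m) (j j' : Fin 2) (f : L2Line) :
    entryL i j (singleL i' j' f) = if i' = i ∧ j' = j then f else 0 := by
  rw [Lp.ext_iff]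
  split_ifs with h
  · filter_upwards [coeFn_entryL i j (singleL i' j' f), coeFn_singleL i' j' f] with z h1 h2
    rw [h1, h2, Matrix.single_apply, if_pos h]
  · filter_upwards [coeFn_entryL i j (singleL i' j' f), coeFn_singleL i' j' f,
      Lp.coeFn_zero ℂ 2 volume] with z h1 h2 h3
    rw [h1, h2, h3, Matrix.single_apply, if_neg h]
    rfl

theorem L2Mat_ext_iff {Ψ Φ : L2Mat m} : Ψ = Φ ↔ ∀ i j, entryL i j Ψ = entryL i j Φ := by
  refine ⟨fun h i j => by rw [h], fun h => ?_⟩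
  rw [Lp.ext_iff]
  have h1 : ∀ᵐ z : ℝ, ∀ i j, Ψ z i j = Φ z i j := by
    refine ae_all_iff.2 fun i => ae_all_iff.2 fun j => ?_
    filter_upwards [coeFn_entryL i j Ψ, coeFn_entryL i j Φ] with z h1 h2
    rw [← h1, ← h2, h i j]
  filter_upwards [h1] with z hz
  ext i j
  exact hz i j

theorem norm_sq_L2Mat (Ψ : L2Mat m) : ‖Ψ‖ ^ 2 = ∑ i, ∑ j, ‖entryL i j Ψ‖ ^ 2 := by
  simp only [Lp_norm_sq_eq_integral]
  have hint : ∀ i j, Integrable fun z => ‖entryL i j Ψ z‖ ^ 2 := fun i j =>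
    (Lp.memLp (entryL i j Ψ)).integrable_norm_pow two_ne_zero
  simp only [← integral_finsetSum _ fun j _ => hint _ j]
  rw [← integral_finsetSum _ fun i _ => integrable_finsetSum _ fun j _ => hint i j]
  have h1 : ∀ᵐ z : ℝ, ∀ i j, entryL i j Ψ z = Ψ z i j :=
    ae_all_iff.2 fun i => ae_all_iff.2 fun j => coeFn_entryL i j Ψ
  refine integral_congr_ae ?_
  filter_upwards [h1] with z hz
  simp only [frobenius_norm_sq, hz]

/-- The matrix valued `L²` function with given entries. -/
def assembleL (φ : Fin m → Fin 2 → L2Line) : L2Mat m := ∑ i, ∑ j, singleL i j (φ i j)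

theorem entryL_assembleL (φ : Fin m → Fin 2 → L2Line) (i : Fin m) (j : Fin 2) :
    entryL i j (assembleL φ) = φ i j := by
  simp only [assembleL, map_sum, entryL_singleL, ite_and]
  rw [Finset.sum_eq_single i, Finset.sum_eq_single j] <;> simp +contextual

/-! ### The Plemelj operator of the jump matrix -/

/-- The `(i, j)` entry of `Ψ S`, when `S` has the factors `A` and `B`. -/
def jumpEntryL (A B : L2Line →L[ℂ] L2Line) (i : Fin m) : Fin 2 → L2Mat m →L[ℂ] L2Line :=
  ![B ∘L (A ∘L entryL i 0 + entryL i 1), A ∘L entryL i 0]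

/-- The operator `I - P_S⁻`. -/
def jumpOp (A B : L2Line →L[ℂ] L2Line) : L2Mat m →L[ℂ] L2Mat m :=
  .id ℂ _ + ∑ i, ∑ j, singleL i j ∘L projMinus ∘L jumpEntryL A B i j

theorem entryL_jumpOp (A B : L2Line →L[ℂ] L2Line) (Ψ : L2Mat m) (i : Fin m) (j : Fin 2) :
    entryL i j (jumpOp A B Ψ) = entryL i j Ψ + projMinus (jumpEntryL A B i j Ψ) := by
  have : jumpOp A B Ψ = Ψ + assembleL fun i j => projMinus (jumpEntryL A B i j Ψ) := by
    simp [jumpOp, assembleL, _root_.sum_apply]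
  rw [this, map_add, entryL_assembleL]

theorem jumpOp_eq_iff {A B : L2Line →L[ℂ] L2Line} {Ψ F : L2Mat m} :
    jumpOp A B Ψ = F ↔ ∀ i, SolvesRow A B (entryL i 0 Ψ) (entryL i 1 Ψ)
      (entryL i 0 F) (entryL i 1 F) := by
  simp only [L2Mat_ext_iff, entryL_jumpOp, Fin.forall_fin_two]
  rfl

theorem bijective_jumpOp {A : L2Line →L[ℂ] L2Line} (hA : ∀ f, ‖A f‖ ≤ ‖f‖) {B : ℝ → ℂ}
    (hB : MemLp B ∞ volume) (h1 : ∀ᵐ z : ℝ, ‖B z‖ ≤ 1) (hc : Continuous B)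
    (h0 : Tendsto B (cocompact ℝ) (𝓝 0)) :
    Function.Bijective (jumpOp A (mulOp B hB) : L2Mat m →L[ℂ] L2Mat m) := by
  constructor
  · rw [injective_iff_map_eq_zero]
    intro Ψ hΨ
    rw [jumpOp_eq_iff] at hΨ
    simp only [map_zero] at hΨ
    rw [L2Mat_ext_iff]
    simp only [Fin.forall_fin_two, map_zero]
    exact fun i => (hΨ i).eq_zero hA h1 h0
  · intro F
    choose a b hab using fun i : Fin m =>
      exists_solvesRow (hB := hB) hA h1 hc h0 (entryL i 0 F) (entryL i 1 F)
    refine ⟨assembleL fun i => ![a i, b i], jumpOp_eq_iff.2 fun i => ?_⟩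
    rw [entryL_assembleL, entryL_assembleL]
    exact hab i

/-- Squared norms add over rows, so the row bound carries over with a constant independent of `m`.
-/
theorem norm_le_of_jumpOp_eq {A B : L2Line →L[ℂ] L2Line} {α β : ℝ}
    (hα : 0 ≤ α) (hα1 : α ≤ 1) (hβ1 : β ≤ 1) (hαβ : α * β < 1)
    (hA : ∀ f, ‖A f‖ ≤ α * ‖f‖) (hB : ∀ f, ‖B f‖ ≤ β * ‖f‖) {Ψ F : L2Mat m}
    (h : jumpOp A B Ψ = F) : ‖Ψ‖ ≤ 6 * (1 + (1 - α * β)⁻¹) * ‖F‖ := by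
  have hpos : 0 < (1 - α * β)⁻¹ := inv_pos.2 (sub_pos.2 hαβ)
  refine pow_le_pow_iff_left₀ (norm_nonneg _) (by positivity) two_ne_zero |>.1 ?_
  rw [mul_pow, norm_sq_L2Mat, norm_sq_L2Mat, Finset.mul_sum]
  refine Finset.sum_le_sum fun i _ => ?_
  rw [Fin.sum_univ_two, Fin.sum_univ_two]
  exact (jumpOp_eq_iff.1 h i).norm_le hα hα1 hβ1 hαβ hA hB

/-- The upper triangular factor of the jump matrix. -/
def jumpUpper (σ : ℝ) (r₂ : ℝ → ℂ) (x z : ℝ) : ℂ :=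
  σ * r₂ z * Complex.exp (2 * Complex.I * x * z)

/-- The lower triangular factor of the jump matrix. -/
def jumpLower (r₁ : ℝ → ℂ) (x z : ℝ) : ℂ := r₁ z * Complex.exp (-2 * Complex.I * x * z)

theorem norm_jumpUpper {σ : ℝ} (hσ : σ = 1 ∨ σ = -1) (r₂ : ℝ → ℂ) (x z : ℝ) :
    ‖jumpUpper σ r₂ x z‖ = ‖r₂ z‖ := by
  have h : (2 * Complex.I * x * z : ℂ) = ((2 * x * z : ℝ) : ℂ) * Complex.I := by
    push_cast; ring
  rw [jumpUpper, h, norm_mul, norm_mul, Complex.norm_exp_ofReal_mul_I]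
  rcases hσ with rfl | rfl <;> simp

theorem norm_jumpLower (r₁ : ℝ → ℂ) (x z : ℝ) : ‖jumpLower r₁ x z‖ = ‖r₁ z‖ := by
  have h : (-2 * Complex.I * x * z : ℂ) = ((-2 * x * z : ℝ) : ℂ) * Complex.I := by
    push_cast; ring
  rw [jumpLower, h, norm_mul, Complex.norm_exp_ofReal_mul_I, mul_one]

theorem memLp_jumpUpper {σ : ℝ} (hσ : σ = 1 ∨ σ = -1) {r₂ : ℝ → ℂ}
    (hr : AEStronglyMeasurable r₂ volume) (h1 : ∀ᵐ z : ℝ, ‖r₂ z‖ ≤ 1) (x : ℝ) :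
    MemLp (jumpUpper σ r₂ x) ∞ volume :=
  memLp_top_of_bound ((hr.const_mul _).mul (Continuous.aestronglyMeasurable (by fun_prop))) 1
    (by filter_upwards [h1] with z hz; rwa [norm_jumpUpper hσ])

theorem memLp_jumpLower {r₁ : ℝ → ℂ}
    (hr : AEStronglyMeasurable r₁ volume) (h1 : ∀ᵐ z : ℝ, ‖r₁ z‖ ≤ 1) (x : ℝ) :
    MemLp (jumpLower r₁ x) ∞ volume :=
  memLp_top_of_bound (hr.mul (Continuous.aestronglyMeasurable (by fun_prop))) 1
    (by filter_upwards [h1] with z hz; rwa [norm_jumpLower])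

theorem HasPlemeljMinusAt.congr_ae {f g : ℝ → ℂ} {z : ℝ} {l : ℂ} (h : HasPlemeljMinusAt f z l)
    (hfg : f =ᵐ[volume] g) : HasPlemeljMinusAt g z l := by
  have : cauchyIntegral f = cauchyIntegral g := by
    ext w
    simp only [cauchyIntegral]
    congr 1
    refine integral_congr_ae ?_
    filter_upwards [hfg] with ζ hζ
    rw [hζ]
  rwa [HasPlemeljMinusAt, ← this]

section jump

variable {σ : ℝ} {r₁ r₂ : ℝ → ℂ} {x : ℝ} (hU : MemLp (jumpUpper σ r₂ x) ∞ volume)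
  (hL : MemLp (jumpLower r₁ x) ∞ volume)

theorem coeFn_jumpEntryL (Ψ : L2Mat m) (i : Fin m) (j : Fin 2) :
    jumpEntryL (mulOp _ hU) (mulOp _ hL) i j Ψ =ᵐ[volume]
      fun ζ => (Ψ ζ * jumpS σ r₁ r₂ x ζ) i j := by
  -- The two oscillating factors cancel in the product of `jumpUpper` and `jumpLower`, giving the
  -- diagonal entry `σ r₁ r₂`.
  have hexp : ∀ z : ℝ, Complex.exp (2 * Complex.I * x * z) *
      Complex.exp (-2 * Complex.I * x * z) = 1 := fun z => by
    rw [← Complex.exp_add, ← Complex.exp_zero]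
    congr 1
    ring
  revert j
  rw [Fin.forall_fin_two]
  constructor
  · filter_upwards [coeFn_mulOp hL (mulOp _ hU (entryL i 0 Ψ) + entryL i 1 Ψ),
      Lp.coeFn_add (mulOp _ hU (entryL i 0 Ψ)) (entryL i 1 Ψ), coeFn_mulOp hU (entryL i 0 Ψ),
      coeFn_entryL i 0 Ψ, coeFn_entryL i 1 Ψ] with z h1 h2 h3 h4 h5
    change (mulOp _ hL (mulOp _ hU (entryL i 0 Ψ) + entryL i 1 Ψ)) z = _
    rw [h1, h2, Pi.add_apply, h3, h4, h5, Matrix.mul_apply, Fin.sum_univ_two]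
    simp only [jumpUpper, jumpLower, jumpS, Matrix.of_apply, Matrix.cons_val', Matrix.cons_val_zero,
      Matrix.cons_val_one, Matrix.cons_val_fin_one]
    linear_combination (σ * r₁ z * r₂ z * Ψ z i 0) * hexp z
  · filter_upwards [coeFn_mulOp hU (entryL i 0 Ψ), coeFn_entryL i 0 Ψ] with z h3 h4
    change (mulOp _ hU (entryL i 0 Ψ)) z = _
    rw [h3, h4, Matrix.mul_apply, Fin.sum_univ_two]
    simp only [jumpUpper, jumpS, Matrix.of_apply, Matrix.cons_val', Matrix.cons_val_zero,
      Matrix.cons_val_one, Matrix.cons_val_fin_one]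
    ring

theorem ae_hasPlemeljMinusAt_jump (Ψ : L2Mat m) :
    ∀ᵐ z : ℝ, ∀ i j, HasPlemeljMinusAt (fun ζ => (Ψ ζ * jumpS σ r₁ r₂ x ζ) i j) z
      (-(projMinus (jumpEntryL (mulOp _ hU) (mulOp _ hL) i j Ψ)) z) := by
  refine ae_all_iff.2 fun i => ae_all_iff.2 fun j => ?_
  filter_upwards [ae_hasPlemeljMinusAt (jumpEntryL (mulOp _ hU) (mulOp _ hL) i j Ψ)] with z hz
  exact hz.congr_ae (coeFn_jumpEntryL hU hL Ψ i j)

theorem plemeljS_ae_eq (Ψ : L2Mat m) :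
    plemeljS (jumpS σ r₁ r₂ x) Ψ =ᵐ[volume]
      (Ψ - jumpOp (mulOp _ hU) (mulOp _ hL) Ψ : L2Mat m) := by
  have h1 : ∀ᵐ z : ℝ, ∀ i j, (Ψ - jumpOp (mulOp _ hU) (mulOp _ hL) Ψ : L2Mat m) z i j =
      -(projMinus (jumpEntryL (mulOp _ hU) (mulOp _ hL) i j Ψ)) z := by
    refine ae_all_iff.2 fun i => ae_all_iff.2 fun j => ?_
    filter_upwards [coeFn_entryL i j (Ψ - jumpOp (mulOp _ hU) (mulOp _ hL) Ψ),
      Lp.coeFn_neg (projMinus (jumpEntryL (mulOp _ hU) (mulOp _ hL) i j Ψ))] with z hz hz2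
    rw [← hz, map_sub, entryL_jumpOp, sub_add_cancel_left, hz2, Pi.neg_apply]
  filter_upwards [ae_hasPlemeljMinusAt_jump hU hL Ψ, h1] with z hz hz1
  ext i j
  rw [hz1]
  exact (hz i j).limUnder_eq

theorem solvesEq_iff {Ψ F : L2Mat m} :
    SolvesEq (jumpS σ r₁ r₂ x) Ψ F ↔ jumpOp (mulOp _ hU) (mulOp _ hL) Ψ = F := by
  rw [SolvesEq, Lp.ext_iff]
  have h := plemeljS_ae_eq hU hL Ψ
  have h2 := Lp.coeFn_sub Ψ (jumpOp (mulOp _ hU) (mulOp _ hL) Ψ)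
  refine eventually_congr ?_
  filter_upwards [h, h2] with z hz hz2
  rw [hz, hz2, Pi.sub_apply, sub_sub_cancel]

end jump

/-- Replacing `r₁` by its continuous representative leaves the multiplication operator unchanged.
The factor containing `r₂` enters only as a contraction. -/
theorem bijective_jumpOp_jump {σ : ℝ} {r₁ r₂ : ℝ → ℂ} {x : ℝ} (hσ : σ = 1 ∨ σ = -1)
    (hr₁ : MemH1 r₁) (h₁ : ∀ᵐ z : ℝ, ‖r₁ z‖ ≤ 1) (h₂ : ∀ᵐ z : ℝ, ‖r₂ z‖ ≤ 1)
    (hU : MemLp (jumpUpper σ r₂ x) ∞ volume) (hL : MemLp (jumpLower r₁ x) ∞ volume) :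
    Function.Bijective (jumpOp (mulOp _ hU) (mulOp _ hL) : L2Mat m →L[ℂ] L2Mat m) := by
  obtain ⟨r₀, hc, h0, hae⟩ := hr₁.exists_continuous_ae_eq
  have h₀ : ∀ᵐ z : ℝ, ‖r₀ z‖ ≤ 1 := by
    filter_upwards [h₁, hae] with z hz hz2
    rwa [← hz2]
  have hL₀ : MemLp (jumpLower r₀ x) ∞ volume := memLp_jumpLower hc.aestronglyMeasurable h₀ x
  have heq : mulOp _ hL = mulOp _ hL₀ := mulOp_congr (by
    filter_upwards [hae] with z hz
    rw [jumpLower, hz, jumpLower])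
  rw [heq]
  refine bijective_jumpOp (fun f => ?_) hL₀ ?_ ?_ ?_
  · refine (norm_mulOp_apply_le (C := 1) ?_ f).trans_eq (one_mul _)
    filter_upwards [h₂] with z hz
    rwa [norm_jumpUpper hσ]
  · filter_upwards [h₀] with z hz
    rwa [norm_jumpLower]
  · exact hc.mul (by fun_prop)
  · rw [tendsto_zero_iff_norm_tendsto_zero] at h0 ⊢
    simpa only [norm_jumpLower] using h0

theorem ae_norm_le_of_eLpNorm_top_le {r : ℝ → ℂ} {ρ : ℝ}
    (h : eLpNorm r ∞ volume ≤ ENNReal.ofReal ρ) : ∀ᵐ z : ℝ, ‖r z‖ ≤ max ρ 0 := by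
  rw [eLpNorm_exponent_top] at h
  filter_upwards [ae_le_eLpNormEssSup (f := r) (μ := volume)] with z hz
  have h1 := hz.trans h
  rw [← ofReal_norm, ENNReal.ofReal_le_ofReal_iff'] at h1
  exact le_max_iff.2 h1

end

theorem mainTheorem4 :
    -- well-posedness and bounded invertibility for `|r₁|, |r₂| ≤ 1`
    (∀ (σ : ℝ) (r₁ r₂ : ℝ → ℂ) (x : ℝ) (m : ℕ), (σ = 1 ∨ σ = -1) →
      MemH1 r₁ → MemH1 r₂ → (∀ᵐ z : ℝ, ‖r₁ z‖ ≤ 1) → (∀ᵐ z : ℝ, ‖r₂ z‖ ≤ 1) →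
      -- the limits that define `P_S⁻ Ψ` exist almost everywhere, and `P_S⁻ Ψ` is in `L²`
      (∀ Ψ : L2Mat m,
        (∀ᵐ z : ℝ, ∀ i j, ∃ l : ℂ,
          HasPlemeljMinusAt (fun ζ => (Ψ ζ * jumpS σ r₁ r₂ x ζ) i j) z l) ∧
        MemLp (plemeljS (jumpS σ r₁ r₂ x) Ψ) 2 volume) ∧
      -- unique solvability
      (∀ F : L2Mat m, ∃! Ψ : L2Mat m, SolvesEq (jumpS σ r₁ r₂ x) Ψ F) ∧
      -- the inverse of `I - P_S⁻` is a bounded linear operator on `L²`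
      (∃ R : L2Mat m →L[ℂ] L2Mat m, ∀ F Ψ : L2Mat m,
        SolvesEq (jumpS σ r₁ r₂ x) Ψ F ↔ Ψ = R F)) ∧
    -- the bound on the inverse depends only on the sup norms of `r₁` and `r₂`
    (∀ ρ₁ ρ₂ : ℝ, ρ₁ ≤ 1 → ρ₂ ≤ 1 → ρ₁ + ρ₂ < 2 →
      ∃ c : ℝ, 0 < c ∧
        ∀ (σ : ℝ) (r₁ r₂ : ℝ → ℂ) (x : ℝ) (m : ℕ), (σ = 1 ∨ σ = -1) →
          MemH1 r₁ → MemH1 r₂ →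
          eLpNorm r₁ ∞ volume ≤ ENNReal.ofReal ρ₁ → eLpNorm r₂ ∞ volume ≤ ENNReal.ofReal ρ₂ →
          ∀ F Ψ : L2Mat m, SolvesEq (jumpS σ r₁ r₂ x) Ψ F → ‖Ψ‖ ≤ c * ‖F‖) := by
  refine ⟨fun σ r₁ r₂ x m hσ hr₁ hr₂ h₁ h₂ => ?_, fun ρ₁ ρ₂ hρ₁ hρ₂ hρ => ?_⟩
  · have hU : MemLp (jumpUpper σ r₂ x) ∞ volume := memLp_jumpUpper hσ hr₂.choose.1 h₂ x
    have hL : MemLp (jumpLower r₁ x) ∞ volume := memLp_jumpLower hr₁.choose.1 h₁ x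
    have hbij := bijective_jumpOp_jump (m := m) hσ hr₁ h₁ h₂ hU hL
    refine ⟨fun Ψ => ⟨?_, ?_⟩, fun F => ?_, ?_⟩
    · filter_upwards [ae_hasPlemeljMinusAt_jump hU hL Ψ] with z hz i j
      exact ⟨_, hz i j⟩
    · exact (memLp_congr_ae (plemeljS_ae_eq hU hL Ψ)).2 (Lp.memLp _)
    · simp only [solvesEq_iff hU hL]
      exact hbij.existsUnique F
    -- Boundedness of the inverse is the open mapping theorem; no explicit constant is available
    -- when both sup norms equal 1.
    · let e := ContinuousLinearEquiv.ofBijective _ (LinearMap.ker_eq_bot.2 hbij.1)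
        (LinearMap.range_eq_top.2 hbij.2)
      refine ⟨(e.symm : L2Mat m →L[ℂ] L2Mat m), fun F Ψ => ?_⟩
      rw [solvesEq_iff hU hL]
      exact e.eq_symm_apply.symm
  · have hα1 : max ρ₂ 0 ≤ 1 := max_le hρ₂ zero_le_one
    have hβ1 : max ρ₁ 0 ≤ 1 := max_le hρ₁ zero_le_one
    -- At least one of `ρ₁`, `ρ₂` is below 1, and the other factor is at most 1.
    have hαβ : max ρ₂ 0 * max ρ₁ 0 < 1 := by
      rcases lt_or_ge ρ₂ 1 with h | h
      · exact (mul_le_of_le_one_right (le_max_right _ _) hβ1).trans_lt (max_lt h one_pos)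
      · exact (mul_le_of_le_one_left (le_max_right _ _) hα1).trans_lt
          (max_lt (by linarith) one_pos)
    have hpos : 0 < (1 - max ρ₂ 0 * max ρ₁ 0)⁻¹ := inv_pos.2 (sub_pos.2 hαβ)
    refine ⟨6 * (1 + (1 - max ρ₂ 0 * max ρ₁ 0)⁻¹), by positivity, ?_⟩
    intro σ r₁ r₂ x m hσ hr₁ hr₂ h₁ h₂ F Ψ h
    have h₁' := ae_norm_le_of_eLpNorm_top_le h₁
    have h₂' := ae_norm_le_of_eLpNorm_top_le h₂
    have hU : MemLp (jumpUpper σ r₂ x) ∞ volume :=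
      memLp_jumpUpper hσ hr₂.choose.1 (h₂'.mono fun z hz => hz.trans hα1) x
    have hL : MemLp (jumpLower r₁ x) ∞ volume :=
      memLp_jumpLower hr₁.choose.1 (h₁'.mono fun z hz => hz.trans hβ1) x
    refine norm_le_of_jumpOp_eq (le_max_right _ _) hα1 hβ1 hαβ
      (norm_mulOp_apply_le (hB := hU) ?_) (norm_mulOp_apply_le (hB := hL) ?_)
      ((solvesEq_iff hU hL).1 h)
    · filter_upwards [h₂'] with z hz
      rwa [norm_jumpUpper hσ]
    · filter_upwards [h₁'] with z hz
      rwa [norm_jumpLower]
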